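/- **Setting.** A *semi-graph* $S$ consists of a finite set of nodes, a finite set of edges and an incidence relation between them (whose pairs are the half-edges $H(S)$) such that every edge is incident to at most two nodes. The number of edges incident to a node $v$ is its degree $\deg v$, the number of nodes incident to an edge $e$ is its rank. The *underlying graph* of $S$ is the simple graph on its nodes in which two distinct nodes are adjacent if they are incident to a common edge; the *underlying degree* of $S$ is the maximum degree of this graph. A finite simple graph is regarded as a semi-graph with all edges of rank $2$. A *node-edge-checkable problem* $\Pi=(\Sigma,\mathcal N,\mathcal E)$ consists of a (possibly infinite) label set $\Sigma$, for each $i\ge 0$ a collection $\mathcal N^i$ of multisets over $\Sigma$ of cardinality $i$, and for each $i\in\{0,1,2\}$ a collection $\mathcal E^i$ of multisets over $\Sigma$ of cardinality $i$. A solution of $\Pi$ on $S$ is a map $h:H(S)\to\Sigma$ such that for every node $v$ the multiset of labels on its half-edges lies in $\mathcal N^{\deg v}$, and for every edge $e$ the multiset of labels on its half-edges lies in $\mathcal E^{\operatorname{rank} e}$. An instance of the *node-list variant* $\Pi^*$ is a semi-graph $S$ together with an input at every node $v$ of the form $\mathcal N^{i}_{\psi}=\{\chi : |\chi|=i,\ \chi\cup\psi\in\mathcal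 N^{i+j}\}$ with $i=\deg v$, for some $j\ge 0$ and $\psi\in\mathcal N^j$; a solution is a map $h:H(S)\to\Sigma$ such that at every node the multiset of labels lies in its input collection, and at every edge it lies in $\mathcal E^{\operatorname{rank} e}$. Algorithms are deterministic algorithms in the LOCAL model: the nodes carry distinct identifiers from $\{1,\dots,n^c\}$, where $n\geq 1$ is the number of nodes and $c\ge 1$ is a fixed integer; every node initially knows $n$, the maximum degree $\Delta$ of the underlying graph, its identifier and its degree; in synchronous rounds, nodes exchange messages of unbounded size over the edges of rank $2$ and perform unbounded local computation; after a number of rounds that depends only on $n$ and $\Delta$, every node outputs a label for each of its half-edges. The *arboricity* of a graph is the smallest number of forests into which its edges can be partitioned. $\log^* n$ is the number of times $\log_2$ must be applied to $n$ to reach a value at most $1$. **Theorem.** Let $\Pi$ be a node-edge-checkable problem and let $f:\mathbb R_{\ge0}\to\mathbb R_{\ge0}$ be continuous and monotonically non-decreasing with $f(0)=0$ and $f(x)>0$ for some $x$. Let $g$ be a function with values in $\mathbb R_{\ge 0}$ satisfying $g(n)^{f(g(n))}=n$ for all integers $n\ge1$. Assume that * there is an algorithm that solves $\Pi$ on every (non-empty)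 semi-graph in $O(f(\Delta)+\log^* n)$ rounds, where $n$ is the number of nodes and $\Delta$ the underlying degree, and * $\Pi^*$ has a solution on every instance. Then there is a constant $C$ (which depends neither on $\rho$ nor on $a$) such that for all positive integers $\rho$ and $a$ there is an algorithm (which may depend on $\rho$ and $a$) that, on every graph of arboricity at most $a$ whose number $n\geq 1$ of nodes satisfies $a\le \frac{g(n)^{\rho}}5$, solves $\Pi$ in at most $$C\cdot\Big(a+\frac{\rho\cdot f(g(n)^\rho)}{\rho-\log_{g(n)}a}+\log^* n\Big)$$ rounds. -/

import Mathlib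

open scoped NNReal

universe u

/-- A semi-graph: nodes `V`, edges `E` and an incidence relation (the set of half-edges) such that
every edge is incident to at most two nodes. Edges with one or no endpoint and parallel edges are
allowed. -/
structure SemiGraph (V E : Type) where
  Inc : V → E → Prop
  rank_le_two : ∀ e, {v | Inc v e}.encard ≤ 2

namespace SemiGraph

variable {V E : Type}

/-- The half-edges of a semi-graph: incident pairs of a node and an edge. -/
abbrev HalfEdge (S : SemiGraph V E) : Type := {h : V × E // S.Inc h.1 h.2}

/-- The degree of a node: the number of incident edges, of any rank. -/
noncomputable def degree (S : SemiGraph V E) (v : V) : ℕ := Nat.card {e // S.Inc v e}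

/-- The rank of an edge: the number of incident nodes. -/
noncomputable def rank (S : SemiGraph V E) (e : E) : ℕ := Nat.card {v // S.Inc v e}

/-- The underlying graph: two distinct nodes are adjacent if they share an edge. -/
def underlying (S : SemiGraph V E) : SimpleGraph V where
  Adj u v := u ≠ v ∧ ∃ e, S.Inc u e ∧ S.Inc v e
  symm := ⟨fun _ _ h => ⟨h.1.symm, h.2.imp fun _ he => ⟨he.2, he.1⟩⟩⟩
  loopless := ⟨fun _ h => h.1 rfl⟩

/-- The underlying degree of a finite semi-graph: the maximum degree of its underlying graph. -/
noncomputable def underlyingDegree (S : SemiGraph V E) : ℕ :=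
  ⨆ v : V, (S.underlying.neighborSet v).ncard

/-- The multiset of labels on the half-edges incident to the node `v`. -/
noncomputable def nodeConfig {L : Type u} [Finite E] (S : SemiGraph V E) (h : S.HalfEdge → L)
    (v : V) : Multiset L :=
  letI : Fintype {e // S.Inc v e} := Fintype.ofFinite _
  (Finset.univ : Finset {e // S.Inc v e}).val.map fun e => h ⟨(v, e.1), e.2⟩

/-- The multiset of labels on the half-edges incident to the edge `e`. -/
noncomputable def edgeConfig {L : Type u} [Finite V] (S : SemiGraph V E) (h : S.HalfEdge → L)
    (e : E) : Multiset L :=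
  letI : Fintype {v // S.Inc v e} := Fintype.ofFinite _
  (Finset.univ : Finset {v // S.Inc v e}).val.map fun v => h ⟨(v.1, e), v.2⟩

end SemiGraph

/-- A simple graph, viewed as a semi-graph all of whose edges have rank two. -/
def SimpleGraph.toSemiGraph {V : Type} (G : SimpleGraph V) : SemiGraph V G.edgeSet where
  Inc v e := v ∈ e.1
  rank_le_two := by
    rintro ⟨e, _⟩
    induction e using Sym2.ind with
    | _ x y =>
      have h : {v | v ∈ s(x, y)} = {x, y} := by ext v; simp
      rw [h]
      refine (Set.encard_insert_le _ _).trans ?_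
      rw [Set.encard_singleton, one_add_one_eq_two]

/-- `G` is the edge-disjoint union of `k` forests on its node set. -/
def SimpleGraph.IsUnionOfForests {V : Type} (G : SimpleGraph V) (k : ℕ) : Prop :=
  ∃ F : Fin k → SimpleGraph V,
    (∀ i, F i ≤ G) ∧ (∀ i, (F i).IsAcyclic) ∧ ∀ e ∈ G.edgeSet, ∃! i, e ∈ (F i).edgeSet

/-- The arboricity of a finite graph: the smallest number of forests into which its edges can be
partitioned. -/
noncomputable def SimpleGraph.arboricity {V : Type} (G : SimpleGraph V) : ℕ :=
  sInf {k | G.IsUnionOfForests k}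

/-- A node-edge-checkable problem with output labels `L`: for each `i`, a collection `node i` of
multisets of cardinality `i`, and for `i = 0, 1, 2` a collection `edge i` of multisets of
cardinality `i` (`edge i` is empty for `i > 2`). -/
structure NodeEdgeProblem (L : Type u) where
  node : ℕ → Set (Multiset L)
  edge : ℕ → Set (Multiset L)
  card_of_mem_node : ∀ i, ∀ m ∈ node i, m.card = i
  card_of_mem_edge : ∀ i, ∀ m ∈ edge i, m.card = i
  edge_eq_empty : ∀ i, 2 < i → edge i = ∅

namespace NodeEdgeProblem

variable {L : Type u} {V E : Type}

/-- `h` is a valid solution of `P` on `S`. -/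
def IsSolution [Finite V] [Finite E] (P : NodeEdgeProblem L) (S : SemiGraph V E)
    (h : S.HalfEdge → L) : Prop :=
  (∀ v, S.nodeConfig h v ∈ P.node (S.degree v)) ∧ ∀ e, S.edgeConfig h e ∈ P.edge (S.rank e)

/-- The multisets of cardinality `i` that complete the node configuration `ψ` to an allowed node
configuration. -/
def completions (P : NodeEdgeProblem L) (i : ℕ) (ψ : Multiset L) : Set (Multiset L) :=
  {χ | χ.card = i ∧ χ + ψ ∈ P.node (i + ψ.card)}

/-- The possible inputs of a node of degree `i` in the node-list variant of `P`. -/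
def nodeLists (P : NodeEdgeProblem L) (i : ℕ) : Set (Set (Multiset L)) :=
  {M | ∃ j, ∃ ψ ∈ P.node j, M = P.completions i ψ}

/-- `(S, hin)` is an input instance of the node-list variant of `P`. -/
def IsNodeListInstance (P : NodeEdgeProblem L) (S : SemiGraph V E)
    (hin : V → Set (Multiset L)) : Prop :=
  ∀ v, hin v ∈ P.nodeLists (S.degree v)

/-- `h` is a valid solution of the node-list variant of `P` on the input `(S, hin)`. -/
def IsNodeListSolution [Finite V] [Finite E] (P : NodeEdgeProblem L) (S : SemiGraph V E)
    (hin : V → Set (Multiset L)) (h : S.HalfEdge → L) : Prop :=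
  (∀ v, S.nodeConfig h v ∈ hin v) ∧ ∀ e, S.edgeConfig h e ∈ P.edge (S.rank e)

end NodeEdgeProblem

/-- The semi-graph `S` as a LOCAL network: the nodes carry distinct identifiers from
`{1, ..., n ^ c}`, where `n` is the number of nodes, and every node of degree `d` addresses its
incident half-edges by ports `0, ..., d - 1`, numbered arbitrarily. -/
structure LocalNetwork {V E : Type} (S : SemiGraph V E) (c : ℕ) where
  id : V → ℕ
  id_injective : Function.Injective id
  one_le_id : ∀ v, 1 ≤ id v
  id_le : ∀ v, id v ≤ Nat.card V ^ c
  port : ∀ v, {e // S.Inc v e} ≃ Fin (S.degree v)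

/-- A deterministic LOCAL algorithm that outputs a label in `L` on every half-edge. States, messages
and local computations are unrestricted. -/
structure LocalAlgorithm (L : Type u) where
  /-- The states of a node. -/
  State : Type u
  /-- The messages. -/
  Msg : Type u
  /-- `init n Δ i d` is the initial state of a node with identifier `i` and degree `d` in a network
  with `n` nodes and underlying degree `Δ`. -/
  init : (n Δ i d : ℕ) → State
  /-- `send s p` is the message that a node in state `s` sends through its port `p`. -/
  send : State → ℕ → Msg
  /-- `receive s m` is the state that follows `s` when `m p` is what arrives through port `p`
  (`none` if nothing arrives there). -/
  receive : State → (ℕ → Option Msg) → State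
  /-- `rounds n Δ` is the number of rounds after which the nodes terminate. -/
  rounds : (n Δ : ℕ) → ℕ
  /-- `out s p` is the label that a node terminating in state `s` puts on the half-edge at
  port `p`. -/
  out : State → ℕ → L

namespace LocalAlgorithm

variable {L : Type u} {V E : Type} {S : SemiGraph V E} {c : ℕ}

open Classical in
/-- What arrives at port `p` of node `v` when the states of the nodes are `st`: if the edge there
has rank two, the message sent through this edge by its other endpoint `u`, and nothing otherwise.
(As edges have rank at most two, `u` is unique.) -/
noncomputable def inbox (A : LocalAlgorithm L) (N : LocalNetwork S c) (st : V → A.State)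
    (v : V) (p : ℕ) : Option A.Msg :=
  if hp : p < S.degree v then
    if hu : ∃ u, u ≠ v ∧ S.Inc u ((N.port v).symm ⟨p, hp⟩).1 then
      some (A.send (st hu.choose) (N.port hu.choose ⟨_, hu.choose_spec.2⟩))
    else none
  else none

/-- The states of the nodes after `t` synchronous rounds. -/
noncomputable def stateAt (A : LocalAlgorithm L) (N : LocalNetwork S c) : ℕ → V → A.State
  | 0 => fun v => A.init (Nat.card V) S.underlyingDegree (N.id v) (S.degree v)
  | t + 1 => fun v => A.receive (A.stateAt N t v) (A.inbox N (A.stateAt N t) v)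

/-- The running time of the algorithm on a network. -/
noncomputable def time (A : LocalAlgorithm L) (_N : LocalNetwork S c) : ℕ :=
  A.rounds (Nat.card V) S.underlyingDegree

/-- The half-edge labeling that the algorithm outputs on a network. -/
noncomputable def output (A : LocalAlgorithm L) (N : LocalNetwork S c) : S.HalfEdge → L :=
  fun h => A.out (A.stateAt N (A.time N) h.1.1) (N.port h.1.1 ⟨h.1.2, h.2⟩)

end LocalAlgorithm

/-- The iterated logarithm `log* n`: how often `log₂` has to be applied to `n` until the result is
at most `1`. (Rounding up in each step does not change this number.) -/
def logStar (n : ℕ) : ℕ :=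
  if h : n ≤ 1 then 0 else logStar (Nat.clog 2 n) + 1
termination_by n
decreasing_by
  have h1 : n - 1 < 2 ^ (n - 1) := Nat.lt_two_pow_self
  have h2 : Nat.clog 2 n ≤ n - 1 := Nat.clog_le_of_le_pow (by omega)
  omega

/-! Put K = ⌊g(n)^ρ⌋ and b = 2a. Arboricity at most a implies that every set of m nodes spans at
most a·m edges. Peel the graph in stages, each removing all nodes that currently have degree at most
K and at most b neighbours of degree above K. Edge counting shows that a stage shrinks the graph by
a factor (K+1)/(4a) (`ncard_remaining_succ_le`), so nothing is left after T stages once (4a)^T·n <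
(K+1)^T. The equation for g turns this into T = O(f(g(n))/(ρ - log_{g(n)} a)) + 1 (`exists_steps`).

An edge from a peeled node to a neighbour of degree above K at that moment is atypical, oriented
away from the peeled node. The other edges form a graph of maximum degree at most K
(`ncard_typical_le`), which the given algorithm labels in O(f(K) + log* n) rounds. Atypical edges
have out-degree at most 2a and lead to strictly later stages. Numbering the out-edges of each node
splits them into 2a forests; colouring each forest by parity along parent pointers and sorting edges
by the colour of their head gives 4a classes, each a disjoint union of stars. The classes are added
one by one: the labels already present around the centre and the leaves of a star define an instance
of Π*, which the centre solves for all its leaves (`solves_extendToStars`). This costs two rounds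
per class, hence O(a) in total.

Locality is treated semantically: a quantity is `Known t` if it is a function of the t-round view,
and the constructions above are shown to preserve this. Once the final labeling is known, a
full-information algorithm outputs it (`exists_output_function`). -/

/-! ### Peeling sparse graphs -/

namespace SimpleGraph

variable {V : Type} (G : SimpleGraph V)

/-- The number of neighbours of `v` in `S`. -/
noncomputable def degIn (S : Set V) (v : V) : ℕ := {u | G.Adj v u ∧ u ∈ S}.ncard

/-- What remains after peeling off `i` times all nodes of degree at most `K` that have at most `b`
neighbours of degree above `K`. -/
def remaining (K b : ℕ) : ℕ → Set V
  | 0 => Set.univ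
  | i + 1 => {v | v ∈ remaining K b i ∧ ¬ (G.degIn (remaining K b i) v ≤ K ∧
      G.degIn {u | u ∈ remaining K b i ∧ K < G.degIn (remaining K b i) u} v ≤ b)}

/-- The node `v` is a neighbour of `u` of degree above `K` when `u` is peeled off. -/
def Atypical (K b : ℕ) (u v : V) : Prop :=
  G.Adj u v ∧ ∃ i, u ∈ G.remaining K b i ∧ u ∉ G.remaining K b (i + 1) ∧
    v ∈ G.remaining K b i ∧ K < G.degIn (G.remaining K b i) v

/-- The graph of the remaining edges. -/
def typical (K b : ℕ) : SimpleGraph V where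
  Adj u v := G.Adj u v ∧ ¬ G.Atypical K b u v ∧ ¬ G.Atypical K b v u
  symm := ⟨fun _ _ h => ⟨h.1.symm, h.2.2, h.2.1⟩⟩
  loopless := ⟨fun _ h => G.irrefl h.1⟩

variable {G} {K b : ℕ}

theorem remaining_anti : Antitone (G.remaining K b) :=
  antitone_nat_of_succ_le fun _ _ h => h.1

/-- The head has degree above K at the stage that peels the tail, so it survives that stage:
atypical edges lead to strictly later stages. -/
theorem Atypical.mem_succ {u v : V} (h : G.Atypical K b u v) {i : ℕ}
    (hi : u ∈ G.remaining K b i) : v ∈ G.remaining K b (i + 1) := by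
  obtain ⟨-, j, -, hj, hv, hd⟩ := h
  have hij : i ≤ j := by
    by_contra! hlt
    exact hj (remaining_anti hlt hi)
  exact remaining_anti (Nat.succ_le_succ hij) ⟨hv, fun h => hd.not_ge h.1⟩

theorem Atypical.asymm {T : ℕ} (hT : G.remaining K b T = ∅) {u v : V} (h : G.Atypical K b u v) :
    ¬ G.Atypical K b v u := by
  intro h'
  have key : ∀ i, u ∈ G.remaining K b i := by
    intro i
    induction i with
    | zero => trivial
    | succ i ih => exact remaining_anti (Nat.le_succ _) (h'.mem_succ (h.mem_succ ih))
  have := key T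
  rw [hT] at this
  exact this

theorem ncard_atypical_le [Finite V] (u : V) : {v | G.Atypical K b u v}.ncard ≤ b := by
  by_cases h : ∃ i, u ∈ G.remaining K b i ∧ u ∉ G.remaining K b (i + 1)
  · obtain ⟨i, hi, hi'⟩ := h
    have hd := not_not.1 fun h => hi' ⟨hi, h⟩
    refine le_trans (Set.ncard_le_ncard ?_ (Set.toFinite _)) hd.2
    rintro v ⟨ha, j, hj, hj', hv, hK⟩
    obtain rfl : i = j := by
      rcases lt_trichotomy i j with h | h | h
      · exact absurd (remaining_anti h hj) hi'
      · exact h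
      · exact absurd (remaining_anti h hi) hj'
    exact ⟨ha, hv, hK⟩
  · have : {v | G.Atypical K b u v} = ∅ :=
      Set.eq_empty_iff_forall_notMem.2 fun v hv =>
        h (hv.2.imp fun _ h => ⟨h.1, h.2.1⟩)
    rw [this, Set.ncard_empty]
    exact Nat.zero_le _

/-- Consider the last stage j at which v and all its typical neighbours are present, and a node x
among them peeled there. If x = v, then v has degree at most K at that stage; otherwise v does too,
or the edge from x to v would be atypical. This degree counts all typical neighbours. -/
theorem ncard_typical_le [Finite V] {T : ℕ} (hT : G.remaining K b T = ∅) (v : V) :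
    {u | (G.typical K b).Adj v u}.ncard ≤ K := by
  classical
  set W := insert v {u | (G.typical K b).Adj v u} with hW
  have hex : ∃ i, ¬ W ⊆ G.remaining K b i :=
    ⟨T, fun h => by have := h (Set.mem_insert v _); rw [hT] at this; exact this⟩
  obtain ⟨j, hj⟩ : ∃ j, Nat.find hex = j + 1 := Nat.exists_eq_succ_of_ne_zero fun h =>
    (h ▸ Nat.find_spec hex : ¬ W ⊆ G.remaining K b 0) fun _ _ => trivial
  have h1 : W ⊆ G.remaining K b j := not_not.1 (Nat.find_min hex (by omega))
  have h2 : ¬ W ⊆ G.remaining K b (j + 1) := hj ▸ Nat.find_spec hex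
  obtain ⟨x, hx, hx'⟩ := Set.not_subset.1 h2
  have hd : G.degIn (G.remaining K b j) v ≤ K := by
    rcases hx with rfl | hx
    · exact (not_not.1 fun h => hx' ⟨h1 (Set.mem_insert x _), h⟩).1
    · by_contra! hK
      exact hx.2.2 ⟨hx.1.symm, j, h1 (Set.mem_insert_of_mem _ hx), hx', h1 (Set.mem_insert v _), hK⟩
  refine le_trans (Set.ncard_le_ncard ?_ (Set.toFinite _)) hd
  exact fun u hu => ⟨hu.1, h1 (Set.mem_insert_of_mem _ hu)⟩

theorem sum_degIn_comm [Finite V] (S T : Finset V) :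
    ∑ v ∈ S, G.degIn T v = ∑ v ∈ T, G.degIn S v := by
  classical
  have h : ∀ (S : Finset V) v, G.degIn S v = ∑ u ∈ S, if G.Adj v u then 1 else 0 := by
    intro S v
    rw [degIn, ← Finset.card_filter, ← Set.ncard_coe_finset]
    congr 1
    ext u
    simp [and_comm]
  simp only [h]
  rw [Finset.sum_comm]
  simp only [G.adj_comm]

theorem degIn_mono [Finite V] {S T : Set V} (h : S ⊆ T) (v : V) : G.degIn S v ≤ G.degIn T v :=
  Set.ncard_le_ncard (fun _ hu => ⟨hu.1, h hu.2⟩) (Set.toFinite _)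

/-- A survivor lies in H (degree above K) or in B (low degree, more than 2a neighbours in H). The
degree sum over R gives |H|(K+1) ≤ 2a|R|. The degree sum over H ∪ B counts every edge between H and
B twice, so 2(2a+1)|B| ≤ 2a(|H|+|B|) and |B| ≤ |H|. -/
theorem ncard_remaining_succ_le [Finite V] {a : ℕ}
    (hG : ∀ W : Finset V, ∑ v ∈ W, G.degIn W v ≤ 2 * a * W.card) (i : ℕ) :
    (G.remaining K (2 * a) (i + 1)).ncard * (K + 1) ≤
      4 * a * (G.remaining K (2 * a) i).ncard := by
  classical
  set R := G.remaining K (2 * a) i with hR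
  set H : Set V := {u | u ∈ R ∧ K < G.degIn R u} with hH
  set B : Set V := {v | v ∈ R ∧ v ∉ H ∧ 2 * a < G.degIn H v} with hB
  have hHf := Set.toFinite H
  have hBf := Set.toFinite B
  have hRf := Set.toFinite R
  have hsub : G.remaining K (2 * a) (i + 1) ⊆ H ∪ B := by
    rintro v ⟨hv, hn⟩
    by_cases hvH : v ∈ H
    · exact .inl hvH
    · refine .inr ⟨hv, hvH, ?_⟩
      by_contra! hle
      exact hn ⟨not_lt.1 fun h => hvH ⟨hv, h⟩, hle⟩
  have hdisj : Disjoint hHf.toFinset hBf.toFinset := by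
    rw [Finset.disjoint_left]
    intro v h1 h2
    exact ((hBf.mem_toFinset).1 h2).2.1 ((hHf.mem_toFinset).1 h1)
  have e1 : H.ncard * (K + 1) ≤ 2 * a * R.ncard := by
    rw [Set.ncard_eq_toFinset_card _ hHf, Set.ncard_eq_toFinset_card _ hRf]
    refine le_trans ?_ (hG hRf.toFinset)
    rw [← smul_eq_mul]
    refine le_trans (Finset.card_nsmul_le_sum _ (fun v => G.degIn hRf.toFinset v) _ ?_)
      (Finset.sum_le_sum_of_subset fun v hv => ?_)
    · intro v hv
      rw [hRf.coe_toFinset]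
      exact ((hHf.mem_toFinset).1 hv).2
    · exact (hRf.mem_toFinset).2 ((hHf.mem_toFinset).1 hv).1
  have e2 : B.ncard ≤ H.ncard := by
    have h1 := hG (hHf.toFinset.disjUnion hBf.toFinset hdisj)
    rw [Finset.sum_disjUnion, Finset.card_disjUnion] at h1
    have h2 : ∑ v ∈ hHf.toFinset, G.degIn hBf.toFinset v ≤
        ∑ v ∈ hHf.toFinset, G.degIn (hHf.toFinset.disjUnion hBf.toFinset hdisj) v :=
      Finset.sum_le_sum fun v _ => degIn_mono (by intro x hx; simp_all) v
    have h3 : ∑ v ∈ hBf.toFinset, G.degIn hHf.toFinset v ≤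
        ∑ v ∈ hBf.toFinset, G.degIn (hHf.toFinset.disjUnion hBf.toFinset hdisj) v :=
      Finset.sum_le_sum fun v _ => degIn_mono (by intro x hx; simp_all) v
    have h4 : hBf.toFinset.card * (2 * a + 1) ≤ ∑ v ∈ hBf.toFinset, G.degIn hHf.toFinset v := by
      rw [← smul_eq_mul]
      refine Finset.card_nsmul_le_sum _ _ _ fun v hv => ?_
      rw [hHf.coe_toFinset]
      exact ((hBf.mem_toFinset).1 hv).2.2
    rw [sum_degIn_comm] at h2
    rw [Set.ncard_eq_toFinset_card _ hHf, Set.ncard_eq_toFinset_card _ hBf]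
    by_contra! hlt
    nlinarith
  have e3 : (G.remaining K (2 * a) (i + 1)).ncard ≤ 2 * H.ncard := by
    have := (Set.ncard_le_ncard hsub (Set.toFinite _)).trans (Set.ncard_union_le H B)
    omega
  nlinarith

theorem remaining_eq_empty [Finite V] {a T : ℕ}
    (hG : ∀ W : Finset V, ∑ v ∈ W, G.degIn W v ≤ 2 * a * W.card)
    (hT : (4 * a) ^ T * Nat.card V < (K + 1) ^ T) : G.remaining K (2 * a) T = ∅ := by
  have key : ∀ i, (G.remaining K (2 * a) i).ncard * (K + 1) ^ i ≤ (4 * a) ^ i * Nat.card V := by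
    intro i
    induction i with
    | zero => simp [remaining, Set.ncard_univ]
    | succ i ih =>
      calc _ = (G.remaining K (2 * a) (i + 1)).ncard * (K + 1) * (K + 1) ^ i := by ring
        _ ≤ 4 * a * (G.remaining K (2 * a) i).ncard * (K + 1) ^ i :=
          Nat.mul_le_mul_right _ (ncard_remaining_succ_le hG i)
        _ = 4 * a * ((G.remaining K (2 * a) i).ncard * (K + 1) ^ i) := by ring
        _ ≤ 4 * a * ((4 * a) ^ i * Nat.card V) := Nat.mul_le_mul_left _ ih
        _ = _ := by ring
  have h := (key T).trans_lt hT
  rw [← Set.ncard_eq_zero (Set.toFinite _)]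
  by_contra hne
  exact h.not_ge (Nat.le_mul_of_pos_left _ (Nat.pos_of_ne_zero hne))

/-! ### Arboricity -/

/-- The forest induced on W extends to a spanning tree of the complete graph on W, which has |W| - 1
edges. -/
theorem IsAcyclic.sum_degIn_le {F : SimpleGraph V} [Finite V] (hF : F.IsAcyclic) (W : Finset V) :
    ∑ v ∈ W, F.degIn W v ≤ 2 * W.card := by
  classical
  rcases W.eq_empty_or_nonempty with rfl | ⟨w, hw⟩
  · simp
  have : Nonempty (W : Set V) := ⟨⟨w, hw⟩⟩
  obtain ⟨T, hT, -, hTt⟩ :=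
    (connected_top (V := (W : Set V))).exists_isTree_le_of_le_of_isAcyclic le_top (hF.induce W)
  have hc := hTt.card_edgeFinset
  have h2 := T.sum_degrees_eq_twice_card_edges
  have hcard : Fintype.card (W : Set V) = W.card := by simp
  have h3 : ∑ v ∈ W, F.degIn W v ≤ ∑ v : (W : Set V), T.degree v := by
    rw [← Finset.sum_coe_sort]
    refine Finset.sum_le_sum fun v _ => ?_
    rw [degIn, ← card_neighborFinset_eq_degree, ← Set.ncard_coe_finset,
      ← Set.ncard_image_of_injective _ Subtype.val_injective]
    refine Set.ncard_le_ncard ?_ (Set.toFinite _)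
    rintro u ⟨ha, hu⟩
    refine ⟨⟨u, hu⟩, ?_, rfl⟩
    simpa using hT (show (F.induce W).Adj v ⟨u, hu⟩ from ha)
  omega

/-- The infimum is attained because the set is nonempty: single edges partition the graph into
forests. -/
theorem isUnionOfForests_arboricity [Finite V] (G : SimpleGraph V) :
    G.IsUnionOfForests G.arboricity := by
  classical
  apply Nat.sInf_mem (s := {k | G.IsUnionOfForests k})
  have := Fintype.ofFinite G.edgeSet
  let e := Fintype.equivFin G.edgeSet
  have hmem : ∀ i x, x ∈ (fromEdgeSet {(e.symm i).1}).edgeSet ↔ x = (e.symm i).1 := by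
    intro i x
    rw [edgeSet_fromEdgeSet]
    refine ⟨fun h => h.1, ?_⟩
    rintro rfl
    exact ⟨rfl, G.not_isDiag_of_mem_edgeSet (e.symm i).2⟩
  refine ⟨_, fun i => fromEdgeSet {(e.symm i).1}, fun i => ?_, fun i => ?_, fun x hx => ?_⟩
  · rw [← edgeSet_subset_edgeSet]
    intro x hx
    rw [(hmem i x).1 hx]
    exact (e.symm i).2
  · intro v w hw
    have h3 := hw.three_le_length
    have hn := hw.isTrail.edges_nodup
    have hs : ∀ x ∈ w.edges, x = (e.symm i).1 := fun x hx =>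
      (hmem i x).1 (w.edges_subset_edgeSet hx)
    rw [← w.length_edges] at h3
    have h4 := List.toFinset_card_of_nodup hn
    have h5 : w.edges.toFinset ⊆ {(e.symm i).1} := fun x hx => by
      simpa using hs x (List.mem_toFinset.1 hx)
    have := Finset.card_le_card h5
    rw [h4, Finset.card_singleton] at this
    omega
  · refine ⟨e ⟨x, hx⟩, (hmem _ _).2 (by simp), fun i hi => ?_⟩
    have := (hmem i x).1 hi
    rw [← show e.symm i = ⟨x, hx⟩ from Subtype.ext this.symm, Equiv.apply_symm_apply]

theorem sum_degIn_le_arboricity [Finite V] (G : SimpleGraph V) (W : Finset V) :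
    ∑ v ∈ W, G.degIn W v ≤ 2 * G.arboricity * W.card := by
  classical
  obtain ⟨F, hle, hF, hun⟩ := G.isUnionOfForests_arboricity
  have h1 : ∀ v, G.degIn W v ≤ ∑ i, (F i).degIn W v := by
    intro v
    have : {u | G.Adj v u ∧ u ∈ (W : Set V)} ⊆
        ⋃ i ∈ (Finset.univ : Finset (Fin G.arboricity)), {u | (F i).Adj v u ∧ u ∈ (W : Set V)} := by
      rintro u ⟨ha, hu⟩
      obtain ⟨i, hi, -⟩ := hun s(v, u) ha
      simp only [Set.mem_iUnion]
      exact ⟨i, Finset.mem_univ _, hi, hu⟩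
    exact (Set.ncard_le_ncard this (Set.toFinite _)).trans (Finset.set_ncard_biUnion_le _ _)
  calc _ ≤ ∑ v ∈ W, ∑ i, (F i).degIn W v := Finset.sum_le_sum fun v _ => h1 v
    _ = ∑ i, ∑ v ∈ W, (F i).degIn W v := Finset.sum_comm
    _ ≤ ∑ i : Fin G.arboricity, 2 * W.card := Finset.sum_le_sum fun i _ => (hF i).sum_degIn_le W
    _ = _ := by simp; ring

end SimpleGraph

/-! ### Networks on simple graphs -/

namespace LocalNetwork

variable {V : Type} {G : SimpleGraph V} {c : ℕ} (N : LocalNetwork G.toSemiGraph c)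

open Classical in
/-- The port of `v` at the edge to `u` (`0` if there is no such edge). -/
noncomputable def prt (v u : V) : ℕ :=
  if h : G.Adj v u then N.port v ⟨⟨s(v, u), h⟩, Sym2.mem_mk_left v u⟩ else 0

open Classical in
/-- The neighbour of `v` at port `p` (`v` itself if there is no such port). -/
noncomputable def nbr (v : V) (p : ℕ) : V :=
  if h : ∃ u, G.Adj v u ∧ N.prt v u = p then h.choose else v

variable {N} {v u w : V}

theorem prt_of_adj (h : G.Adj v u) :
    N.prt v u = N.port v ⟨⟨s(v, u), h⟩, Sym2.mem_mk_left v u⟩ := dif_pos h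

theorem prt_lt (h : G.Adj v u) : N.prt v u < G.toSemiGraph.degree v := by
  rw [prt_of_adj h]; exact Fin.is_lt _

theorem prt_inj (hu : G.Adj v u) (hw : G.Adj v w) (h : N.prt v u = N.prt v w) : u = w := by
  rw [prt_of_adj hu, prt_of_adj hw, Fin.val_inj, (N.port v).apply_eq_iff_eq] at h
  exact Sym2.congr_right.1 (congrArg (fun e => e.1.1) h)

theorem exists_prt_eq {p : ℕ} (hp : p < G.toSemiGraph.degree v) : ∃ u, G.Adj v u ∧ N.prt v u = p := by
  obtain ⟨⟨⟨e, he⟩, hv⟩, h⟩ := (N.port v).surjective ⟨p, hp⟩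
  obtain ⟨u, rfl⟩ : ∃ u, e = s(v, u) := Sym2.mem_iff_exists.1 hv
  exact ⟨u, he, by rw [prt_of_adj he, h]⟩

theorem nbr_prt (h : G.Adj v u) : N.nbr v (N.prt v u) = u := by
  have h' : ∃ w, G.Adj v w ∧ N.prt v w = N.prt v u := ⟨u, h, rfl⟩
  rw [nbr, dif_pos h']
  exact prt_inj h'.choose_spec.1 h h'.choose_spec.2

theorem nbr_of_forall_ne {p : ℕ} (h : ∀ u, G.Adj v u → N.prt v u ≠ p) : N.nbr v p = v := by
  rw [nbr, dif_neg]
  rintro ⟨u, hu, hp⟩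
  exact h u hu hp

theorem prt_self : N.prt v v = 0 := dif_neg G.irrefl

end LocalNetwork

namespace LocalAlgorithm

variable {L : Type u} {V : Type} {G : SimpleGraph V} {c : ℕ} {N : LocalNetwork G.toSemiGraph c}
  (A : LocalAlgorithm L) {v u : V}

theorem inbox_prt (st : V → A.State) (h : G.Adj v u) :
    A.inbox N st v (N.prt v u) = some (A.send (st u) (N.prt u v)) := by
  have hp := LocalNetwork.prt_lt (N := N) h
  have he : ((N.port v).symm ⟨N.prt v u, hp⟩).1 = ⟨s(v, u), h⟩ := by
    have : (⟨N.prt v u, hp⟩ : Fin _) = N.port v ⟨⟨s(v, u), h⟩, Sym2.mem_mk_left v u⟩ :=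
      Fin.ext (LocalNetwork.prt_of_adj h)
    rw [this, Equiv.symm_apply_apply]
  -- The edge, and below it the endpoint, are generalised to variables because the chosen endpoint
  -- and its port depend on them; then substitution applies.
  have key : ∀ e : G.edgeSet, e = ⟨s(v, u), h⟩ → ∀ hu : ∃ w, w ≠ v ∧ G.toSemiGraph.Inc w e,
      A.send (st hu.choose) (N.port hu.choose ⟨_, hu.choose_spec.2⟩) =
        A.send (st u) (N.prt u v) := by
    rintro e rfl hu
    have hw : hu.choose = u := (Sym2.mem_iff.1 hu.choose_spec.2).resolve_left hu.choose_spec.1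
    have : ∀ w (hw : w = u) (hi : G.toSemiGraph.Inc w ⟨s(v, u), h⟩),
        A.send (st w) (N.port w ⟨_, hi⟩) = A.send (st u) (N.prt u v) := by
      rintro w rfl hi
      rw [LocalNetwork.prt_of_adj h.symm]
      have he : (⟨⟨s(v, w), h⟩, hi⟩ : {e // G.toSemiGraph.Inc w e}) =
          ⟨⟨s(w, v), h.symm⟩, Sym2.mem_mk_left w v⟩ := Subtype.ext (Subtype.ext Sym2.eq_swap)
      exact congrArg (fun e => A.send (st w) (N.port w e : ℕ)) he
    exact this _ hw _
  rw [inbox, dif_pos hp, dif_pos ⟨u, h.ne', by rw [he]; exact Sym2.mem_mk_right v u⟩]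
  exact congrArg some (key _ he _)

theorem inbox_eq_none (st : V → A.State) {p : ℕ} (h : ∀ u, G.Adj v u → N.prt v u ≠ p) :
    A.inbox N st v p = none := by
  rw [inbox, dif_neg]
  intro hp
  obtain ⟨u, hu, hpu⟩ := LocalNetwork.exists_prt_eq (N := N) hp
  exact h u hu hpu

end LocalAlgorithm

/-! ### Views and locally determined quantities -/

/-- What a node may know after some rounds of full-information exchange. -/
inductive LocalView : Type
  | init (n Δ i d : ℕ) : LocalView
  | step (own : LocalView) (nbr : ℕ → LocalView) (back : ℕ → ℕ) : LocalView

namespace LocalView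

/-- The number of nodes, as recorded in a view. -/
def size : LocalView → ℕ
  | init n _ _ _ => n
  | step s _ _ => s.size

/-- The identifier recorded in a view. -/
def ident : LocalView → ℕ
  | init _ _ i _ => i
  | step s _ _ => s.ident

/-- The degree recorded in a view. -/
def deg : LocalView → ℕ
  | init _ _ _ d => d
  | step s _ _ => s.deg

end LocalView

namespace LocalNetwork

variable {V : Type} {G : SimpleGraph V} {c : ℕ} (N : LocalNetwork G.toSemiGraph c)

/-- The view of a node after `t` rounds. -/
noncomputable def view : ℕ → V → LocalView
  | 0 => fun v =>
    .init (Nat.card V) G.toSemiGraph.underlyingDegree (N.id v) (G.toSemiGraph.degree v)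
  | t + 1 => fun v =>
    .step (view t v) (fun p => view t (N.nbr v p)) fun p => N.prt (N.nbr v p) v

theorem view_size (t : ℕ) (v : V) : (N.view t v).size = Nat.card V := by
  induction t with
  | zero => rfl
  | succ t ih => exact ih

theorem view_ident (t : ℕ) (v : V) : (N.view t v).ident = N.id v := by
  induction t with
  | zero => rfl
  | succ t ih => exact ih

theorem view_deg (t : ℕ) (v : V) : (N.view t v).deg = G.toSemiGraph.degree v := by
  induction t with
  | zero => rfl
  | succ t ih => exact ih

end LocalNetwork

/-- The full-information algorithm with given running time and output functions. -/
def gatherAlgorithm {L : Type u} (rounds : ℕ → ℕ) (out : LocalView → ℕ → L) :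
    LocalAlgorithm L where
  State := ULift LocalView
  Msg := ULift (LocalView × ℕ)
  init n Δ i d := ⟨.init n Δ i d⟩
  send s p := ⟨s.down, p⟩
  -- Where nothing arrives, the defaults are the own view and port 0, in agreement with `nbr v p =
  -- v` and `prt v v = 0`.
  receive s m := ⟨.step s.down (fun p => ((m p).map fun x => x.down.1).getD s.down)
    fun p => ((m p).map fun x => x.down.2).getD 0⟩
  rounds n _ := rounds n
  out s := out s.down

theorem gatherAlgorithm_stateAt {L : Type u} (rounds : ℕ → ℕ) (out : LocalView → ℕ → L)
    {V : Type} {G : SimpleGraph V} {c : ℕ} (N : LocalNetwork G.toSemiGraph c) (t : ℕ) (v : V) :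
    (gatherAlgorithm rounds out).stateAt N t v = ⟨N.view t v⟩ := by
  induction t generalizing v with
  | zero => rfl
  | succ t ih =>
    set A := gatherAlgorithm rounds out
    have key : ∀ p, A.inbox N (A.stateAt N t) v p = none ∧ N.nbr v p = v ∨
        A.inbox N (A.stateAt N t) v p =
          some (⟨N.view t (N.nbr v p), N.prt (N.nbr v p) v⟩ : ULift (LocalView × ℕ)) := by
      intro p
      by_cases h : ∃ u, G.Adj v u ∧ N.prt v u = p
      · obtain ⟨u, hu, rfl⟩ := h
        right
        rw [LocalAlgorithm.inbox_prt _ _ hu, LocalNetwork.nbr_prt hu, ih]; rfl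
      · push Not at h
        exact .inl ⟨LocalAlgorithm.inbox_eq_none _ _ h, LocalNetwork.nbr_of_forall_ne h⟩
    rw [LocalAlgorithm.stateAt, LocalNetwork.view]
    refine congrArg ULift.up (?_ : LocalView.step (A.stateAt N t v).down
      (fun p => ((A.inbox N (A.stateAt N t) v p).map fun x => x.down.1).getD
        (A.stateAt N t v).down)
      (fun p => ((A.inbox N (A.stateAt N t) v p).map fun x => x.down.2).getD 0) = _)
    rw [ih]
    congr 1 <;> funext p <;> rcases key p with ⟨h1, h2⟩ | h1 <;> rw [h1]
    · rw [h2]; rfl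
    · rfl
    · rw [h2, LocalNetwork.prt_self]; rfl
    · rfl

/-- A network with `n` nodes on a graph in which every set of `m` nodes spans at most `a * m` edges. -/
structure SparseNetwork (n c a : ℕ) where
  V : Type
  [fintype : Fintype V]
  G : SimpleGraph V
  N : LocalNetwork G.toSemiGraph c
  card_eq : Nat.card V = n
  sparse : ∀ W : Finset V, ∑ v ∈ W, G.degIn W v ≤ 2 * a * W.card

namespace SparseNetwork

attribute [instance] SparseNetwork.fintype

variable {n c a : ℕ} {X Y : Type*}

/-- The port of `v` at its neighbour `u`. -/
noncomputable abbrev prt (M : SparseNetwork n c a) (v u : M.V) : ℕ := M.N.prt v u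

/-- A quantity at every node that is determined by what the node sees in `t` rounds. -/
def Known (t : ℕ) (F : ∀ M : SparseNetwork n c a, M.V → X) : Prop :=
  ∀ (M M' : SparseNetwork n c a) (v : M.V) (v' : M'.V),
    M.N.view t v = (M'.N.view t v' : LocalView) → F M v = F M' v'

/-- A quantity at every half-edge that is determined by what its node sees in `t` rounds. -/
def KnownAt (t : ℕ) (H : ∀ M : SparseNetwork n c a, M.V → M.V → X) : Prop :=
  ∀ (M M' : SparseNetwork n c a) (v u : M.V) (v' u' : M'.V),
    M.N.view t v = (M'.N.view t v' : LocalView) → M.G.Adj v u → M'.G.Adj v' u' →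
      M.prt v u = M'.prt v' u' → H M v u = H M' v' u'

section

variable {M M' : SparseNetwork n c a} {v u : M.V} {v' : M'.V}

theorem view_eq_of_le {s t : ℕ} (hst : s ≤ t)
    (h : M.N.view t v = (M'.N.view t v' : LocalView)) :
    M.N.view s v = (M'.N.view s v' : LocalView) := by
  induction hst with
  | refl => exact h
  | step _ ih => exact ih (LocalView.step.inj h).1

theorem id_eq_of_view_eq {t : ℕ} (h : M.N.view t v = (M'.N.view t v' : LocalView)) :
    M.N.id v = M'.N.id v' := by
  rw [← M.N.view_ident t, h, M'.N.view_ident]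

theorem exists_adj_of_view_eq {t : ℕ} (h : M.N.view t v = (M'.N.view t v' : LocalView))
    (hu : M.G.Adj v u) : ∃ u', M'.G.Adj v' u' ∧ M'.prt v' u' = M.prt v u := by
  apply LocalNetwork.exists_prt_eq
  rw [← M'.N.view_deg t, ← h, M.N.view_deg]
  exact LocalNetwork.prt_lt hu

/-- This is why views record the back ports: equal views of v fix the view of a neighbour and also
the port at which that neighbour sees v. -/
theorem view_adj {t : ℕ} {u' : M'.V}
    (h : M.N.view (t + 1) v = (M'.N.view (t + 1) v' : LocalView)) (hu : M.G.Adj v u)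
    (hu' : M'.G.Adj v' u') (hp : M.prt v u = M'.prt v' u') :
    M.N.view t u = (M'.N.view t u' : LocalView) ∧ M.prt u v = M'.prt u' v' := by
  have h2 := LocalView.step.inj h
  have h3 := congrFun h2.2.1 (M.prt v u)
  have h4 := congrFun h2.2.2 (M.prt v u)
  have e1 : M.N.nbr v (M.prt v u) = u := LocalNetwork.nbr_prt hu
  have e2 : M'.N.nbr v' (M.prt v u) = u' := by rw [hp]; exact LocalNetwork.nbr_prt hu'
  rw [e1, e2] at h3 h4
  exact ⟨h3, h4⟩

end

variable {s t : ℕ} {F : ∀ M : SparseNetwork n c a, M.V → X}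
  {H : ∀ M : SparseNetwork n c a, M.V → M.V → X}

theorem Known.mono (hst : s ≤ t) (h : Known s F) : Known t F :=
  fun _ _ _ _ hv => h _ _ _ _ (view_eq_of_le hst hv)

theorem KnownAt.mono (hst : s ≤ t) (h : KnownAt s H) : KnownAt t H :=
  fun _ _ _ _ _ _ hv => h _ _ _ _ _ _ (view_eq_of_le hst hv)

theorem Known.knownAt (h : Known t F) : KnownAt t fun M v _ => F M v :=
  fun _ _ _ _ _ _ hv _ _ _ => h _ _ _ _ hv

theorem Known.map (φ : X → Y) (h : Known t F) : Known t fun M v => φ (F M v) :=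
  fun _ _ _ _ hv => congrArg φ (h _ _ _ _ hv)

theorem KnownAt.map (φ : X → Y) (h : KnownAt t H) : KnownAt t fun M v u => φ (H M v u) :=
  fun _ _ _ _ _ _ hv h1 h2 h3 => congrArg φ (h _ _ _ _ _ _ hv h1 h2 h3)

theorem Known.prod {F' : ∀ M : SparseNetwork n c a, M.V → Y} (h : Known t F) (h' : Known t F') :
    Known t fun M v => (F M v, F' M v) :=
  fun _ _ _ _ hv => Prod.ext (h _ _ _ _ hv) (h' _ _ _ _ hv)

theorem KnownAt.prod {H' : ∀ M : SparseNetwork n c a, M.V → M.V → Y} (h : KnownAt t H)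
    (h' : KnownAt t H') : KnownAt t fun M v u => (H M v u, H' M v u) :=
  fun _ _ _ _ _ _ hv h1 h2 h3 =>
    Prod.ext (h _ _ _ _ _ _ hv h1 h2 h3) (h' _ _ _ _ _ _ hv h1 h2 h3)

theorem Known.pi {ι : Type*} {F : ι → ∀ M : SparseNetwork n c a, M.V → X}
    (h : ∀ i, Known t (F i)) : Known t fun M v i => F i M v :=
  fun _ _ _ _ hv => funext fun i => h i _ _ _ _ hv

theorem KnownAt.prt : KnownAt t fun (M : SparseNetwork n c a) v u => M.prt v u :=
  fun _ _ _ _ _ _ _ _ _ h => h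

theorem KnownAt.const (x : X) : KnownAt t fun (M : SparseNetwork n c a) (_ _ : M.V) => x :=
  fun _ _ _ _ _ _ _ _ _ _ => rfl

theorem Known.const (x : X) : Known t fun (M : SparseNetwork n c a) (_ : M.V) => x :=
  fun _ _ _ _ _ => rfl

/-- One round of communication. -/
theorem KnownAt.swap (h : KnownAt t H) : KnownAt (t + 1) fun M v u => H M u v :=
  fun _ _ _ _ _ _ hv h1 h2 h3 =>
    h _ _ _ _ _ _ (view_adj hv h1 h2 h3).1 h1.symm h2.symm (view_adj hv h1 h2 h3).2

theorem Known.nbr (h : Known t F) : KnownAt (t + 1) fun M _ u => F M u :=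
  h.knownAt.swap

open Classical in
/-- The multiset of the values at the selected half-edges of a node. -/
noncomputable def collect {V : Type} [Fintype V] (R : V → V → Prop) (h : V → V → X) (v : V) :
    Multiset X :=
  (Finset.univ.filter (R v)).val.map (h v)

/-- Equal views have equal degrees, so matching ports is a bijection between the neighbours in the
two networks, and it respects the selection. -/
theorem KnownAt.collect {R : ∀ M : SparseNetwork n c a, M.V → M.V → Prop} (hR : KnownAt t R)
    (h : KnownAt t H) (hadj : ∀ M v u, R M v u → M.G.Adj v u) :
    Known t fun M v => SparseNetwork.collect (R M) (H M) v := by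
  classical
  intro M M' v v' hv
  have : Nonempty M'.V := ⟨v'⟩
  choose! i hi hip using fun u (hu : M.G.Adj v u) => exists_adj_of_view_eq hv hu
  refine Multiset.map_eq_map_of_bij_of_nodup _ _ (Finset.nodup _) (Finset.nodup _)
    (fun u _ => i u) ?_ ?_ ?_ ?_
  · intro u hu
    simp only [Finset.mem_val, Finset.mem_filter, Finset.mem_univ, true_and] at hu ⊢
    have hu' := hadj _ _ _ hu
    rwa [← hR _ _ _ _ _ _ hv hu' (hi u hu') (hip u hu').symm]
  · intro u hu w hw he
    simp only [Finset.mem_val, Finset.mem_filter, Finset.mem_univ, true_and] at hu hw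
    apply LocalNetwork.prt_inj (N := M.N) (hadj _ _ _ hu) (hadj _ _ _ hw)
    have h1 := hip u (hadj _ _ _ hu)
    have h2 := hip w (hadj _ _ _ hw)
    rw [he] at h1
    exact h1.symm.trans h2
  · intro u' hu'
    simp only [Finset.mem_val, Finset.mem_filter, Finset.mem_univ, true_and] at hu'
    have hu2 := hadj _ _ _ hu'
    obtain ⟨u, hu, hp⟩ := exists_adj_of_view_eq hv.symm hu2
    refine ⟨u, ?_, LocalNetwork.prt_inj (N := M'.N) (hi u hu) hu2 ((hip u hu).trans hp)⟩
    simp only [Finset.mem_val, Finset.mem_filter, Finset.mem_univ, true_and]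
    rwa [hR _ _ _ _ _ _ hv hu hu2 hp]
  · intro u hu
    simp only [Finset.mem_val, Finset.mem_filter, Finset.mem_univ, true_and] at hu
    have hu' := hadj _ _ _ hu
    exact h _ _ _ _ _ _ hv hu' (hi u hu') (hip u hu').symm

theorem KnownAt.ncard {R : ∀ M : SparseNetwork n c a, M.V → M.V → Prop} (hR : KnownAt t R)
    (hadj : ∀ M v u, R M v u → M.G.Adj v u) :
    Known t fun M v => {u | R M v u}.ncard := by
  classical
  have h := (hR.collect (KnownAt.const (t := t) ()) hadj).map Multiset.card
  have hc : ∀ (M : SparseNetwork n c a) v, {u | R M v u}.ncard =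
      (SparseNetwork.collect (R M) (fun _ _ => ()) v).card := by
    intro M v
    rw [SparseNetwork.collect, Multiset.card_map, Finset.card_val, ← Set.ncard_coe_finset]
    simp
  intro M M' v v' hv
  simp only [hc]
  exact h _ _ _ _ hv

open Classical in
/-- Half-edge data of a node, listed by ports. -/
noncomputable def byPort (M : SparseNetwork n c a) (R : M.V → M.V → Prop) (h : M.V → M.V → X)
    (v : M.V) (p : ℕ) : Option X :=
  if ∃ u, M.G.Adj v u ∧ M.prt v u = p ∧ R v u then some (h v (M.N.nbr v p)) else none

theorem byPort_prt {M : SparseNetwork n c a} {R : M.V → M.V → Prop} {h : M.V → M.V → X}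
    {v u : M.V} (hu : M.G.Adj v u) (hR : R v u) : M.byPort R h v (M.prt v u) = some (h v u) := by
  rw [byPort, if_pos ⟨u, hu, rfl, hR⟩, LocalNetwork.nbr_prt hu]

theorem byPort_eq_none {M : SparseNetwork n c a} {R : M.V → M.V → Prop} {h : M.V → M.V → X}
    {v : M.V} {p : ℕ} (hR : ∀ u, M.G.Adj v u → M.prt v u = p → ¬ R v u) :
    M.byPort R h v p = none := by
  rw [byPort, if_neg]
  rintro ⟨u, h1, h2, h3⟩
  exact hR u h1 h2 h3

theorem KnownAt.byPort {R : ∀ M : SparseNetwork n c a, M.V → M.V → Prop} (hR : KnownAt t R)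
    (h : KnownAt t H) : Known t fun M v => M.byPort (R M) (H M) v := by
  intro M M' v v' hv
  funext p
  show M.byPort (R M) (H M) v p = M'.byPort (R M') (H M') v' p
  by_cases hp : ∃ u, M.G.Adj v u ∧ M.prt v u = p ∧ R M v u
  · obtain ⟨u, hu, rfl, hr⟩ := hp
    obtain ⟨u', hu', hp'⟩ := exists_adj_of_view_eq hv hu
    rw [byPort_prt hu hr, ← hp', byPort_prt hu', h _ _ _ _ _ _ hv hu hu' hp'.symm]
    rwa [← hR _ _ _ _ _ _ hv hu hu' hp'.symm]
  · rw [byPort_eq_none fun u h1 h2 h3 => hp ⟨u, h1, h2, h3⟩, byPort_eq_none]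
    rintro u' hu' hp' hr'
    obtain ⟨u, hu, hpu⟩ := exists_adj_of_view_eq hv.symm hu'
    exact hp ⟨u, hu, hpu.trans hp', by rwa [hR _ _ _ _ _ _ hv hu hu' hpu]⟩

/-- The rank of `u` among the selected neighbours of `v`, ordered by ports. -/
noncomputable def index (M : SparseNetwork n c a) (R : M.V → M.V → Prop) (v u : M.V) : ℕ :=
  {w | R v w ∧ M.prt v w < M.prt v u}.ncard

/-- Counting selected ports needs no communication. The index serves both as port numbering of a
subgraph and as number of a forest. -/
theorem KnownAt.index {R : ∀ M : SparseNetwork n c a, M.V → M.V → Prop} (hR : KnownAt t R)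
    (hadj : ∀ M v u, R M v u → M.G.Adj v u) : KnownAt t fun M => M.index (R M) := by
  have h : ∀ p, Known t fun (M : SparseNetwork n c a) v => {w | R M v w ∧ M.prt v w < p}.ncard := by
    intro p
    exact KnownAt.ncard ((hR.prod KnownAt.prt).map fun x => x.1 ∧ x.2 < p)
      fun M v u h => hadj M v u h.1
  intro M M' v u v' u' hv _ _ hp
  have := h (M'.prt v' u') _ _ _ _ hv
  rw [← hp] at this
  simp only [SparseNetwork.index]
  rw [← hp]
  exact this

theorem index_lt_ncard {M : SparseNetwork n c a} {R : M.V → M.V → Prop} {v u : M.V}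
    (hu : R v u) : M.index R v u < {w | R v w}.ncard := by
  apply Set.ncard_lt_ncard _ (Set.toFinite _)
  refine ⟨fun w hw => hw.1, fun h => ?_⟩
  exact lt_irrefl _ (h hu).2

theorem index_inj {M : SparseNetwork n c a} {R : M.V → M.V → Prop} {v u w : M.V}
    (hadj : ∀ u, R v u → M.G.Adj v u) (hu : R v u) (hw : R v w)
    (h : M.index R v u = M.index R v w) : u = w := by
  have key : ∀ {x y}, R v x → M.prt v x < M.prt v y → M.index R v x < M.index R v y := by
    intro x y hx hxy
    apply Set.ncard_lt_ncard _ (Set.toFinite _)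
    refine ⟨fun z hz => ⟨hz.1, hz.2.trans hxy⟩, fun h => ?_⟩
    exact lt_irrefl _ (h ⟨hx, hxy⟩).2
  rcases lt_trichotomy (M.prt v u) (M.prt v w) with h1 | h1 | h1
  · exact absurd h (key hu h1).ne
  · exact LocalNetwork.prt_inj (hadj _ hu) (hadj _ hw) h1
  · exact absurd h (key hw h1).ne'

end SparseNetwork

/-! ### Solutions on simple graphs and stars -/

open SparseNetwork (collect)

theorem SemiGraph.card_nodeConfig {L : Type u} {V E : Type} [Finite E] (S : SemiGraph V E)
    (f : S.HalfEdge → L) (v : V) : (S.nodeConfig f v).card = S.degree v := by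
  let : Fintype {e // S.Inc v e} := Fintype.ofFinite _
  rw [SemiGraph.nodeConfig, Multiset.card_map, Finset.card_val, Finset.card_univ,
    SemiGraph.degree, Nat.card_eq_fintype_card]

theorem SemiGraph.card_edgeConfig {L : Type u} {V E : Type} [Finite V] (S : SemiGraph V E)
    (f : S.HalfEdge → L) (e : E) : (S.edgeConfig f e).card = S.rank e := by
  let : Fintype {v // S.Inc v e} := Fintype.ofFinite _
  rw [SemiGraph.edgeConfig, Multiset.card_map, Finset.card_val, Finset.card_univ,
    SemiGraph.rank, Nat.card_eq_fintype_card]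

namespace NodeEdgeProblem

variable {L : Type u} {V : Type} [Fintype V]

/-- `h` is a solution of `P` on the graph with adjacency relation `R`. -/
def Solves (P : NodeEdgeProblem L) (R : V → V → Prop) (h : V → V → L) : Prop :=
  (∀ v, collect R h v ∈ P.node (collect R h v).card) ∧
    ∀ v u, R v u → {h v u, h u v} ∈ P.edge 2

variable {G : SimpleGraph V} {f : G.toSemiGraph.HalfEdge → L} {h : V → V → L}

theorem nodeConfig_toSemiGraph
    (hf : ∀ v u (a : G.Adj v u), f ⟨(v, ⟨s(v, u), a⟩), Sym2.mem_mk_left v u⟩ = h v u) (v : V) :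
    G.toSemiGraph.nodeConfig f v = collect G.Adj h v := by
  classical
  have ho : ∀ e : {e // G.toSemiGraph.Inc v e}, ∃ u, ∃ a : G.Adj v u,
      e = ⟨⟨s(v, u), a⟩, Sym2.mem_mk_left v u⟩ := by
    rintro ⟨⟨e, he⟩, hv⟩
    obtain ⟨u, rfl⟩ : ∃ u, e = s(v, u) := Sym2.mem_iff_exists.1 hv
    exact ⟨u, he, rfl⟩
  choose i hi hie using ho
  refine Multiset.map_eq_map_of_bij_of_nodup _ _ (Finset.nodup _) (Finset.nodup _)
    (fun e _ => i e) ?_ ?_ ?_ ?_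
  · intro e _
    simpa using hi e
  · intro e _ e' _ h
    have h : i e = i e' := h
    rw [hie e, hie e']
    exact Subtype.ext (Subtype.ext (congrArg (fun u => s(v, u)) h))
  · intro u hu
    simp only [Finset.mem_val, Finset.mem_filter, Finset.mem_univ, true_and] at hu
    refine ⟨⟨⟨s(v, u), hu⟩, Sym2.mem_mk_left v u⟩, by simp, ?_⟩
    have := congrArg (fun e => e.1.1) (hie ⟨⟨s(v, u), hu⟩, Sym2.mem_mk_left v u⟩)
    exact (Sym2.congr_right.1 this).symm
  · intro e _
    rw [← hf _ _ (hi e)]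
    exact congrArg (fun e : {e // G.toSemiGraph.Inc v e} => f ⟨(v, e.1), e.2⟩) (hie e)

theorem edgeConfig_toSemiGraph
    (hf : ∀ v u (a : G.Adj v u), f ⟨(v, ⟨s(v, u), a⟩), Sym2.mem_mk_left v u⟩ = h v u) {v u : V}
    (a : G.Adj v u) : G.toSemiGraph.edgeConfig f ⟨s(v, u), a⟩ = {h v u, h u v} := by
  classical
  have hv : G.toSemiGraph.Inc v ⟨s(v, u), a⟩ := Sym2.mem_mk_left v u
  have hu : G.toSemiGraph.Inc u ⟨s(v, u), a⟩ := Sym2.mem_mk_right v u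
  have huniv : (@Finset.univ {x // G.toSemiGraph.Inc x ⟨s(v, u), a⟩} (Fintype.ofFinite _)) =
      {⟨v, hv⟩, ⟨u, hu⟩} := by
    ext ⟨x, hx⟩
    simpa using Sym2.mem_iff.1 hx
  have h2 : f ⟨(u, ⟨s(v, u), a⟩), hu⟩ = h u v := by
    rw [← hf u v a.symm]
    have : (⟨s(v, u), a⟩ : G.edgeSet) = ⟨s(u, v), a.symm⟩ := Subtype.ext Sym2.eq_swap
    congr 3
  rw [SemiGraph.edgeConfig, huniv, Finset.insert_val_of_notMem (by simpa using a.ne),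
    Multiset.map_cons, Finset.singleton_val, Multiset.map_singleton, h2, hf v u a]
  rfl

theorem isSolution_toSemiGraph_iff (P : NodeEdgeProblem L)
    (hf : ∀ v u (a : G.Adj v u), f ⟨(v, ⟨s(v, u), a⟩), Sym2.mem_mk_left v u⟩ = h v u) :
    P.IsSolution G.toSemiGraph f ↔ P.Solves G.Adj h := by
  refine and_congr (forall_congr' fun v => ?_) ?_
  · rw [← SemiGraph.card_nodeConfig G.toSemiGraph f, nodeConfig_toSemiGraph hf]
  · have hr : ∀ v u (a : G.Adj v u), (G.toSemiGraph.edgeConfig f ⟨s(v, u), a⟩ ∈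
        P.edge (G.toSemiGraph.rank ⟨s(v, u), a⟩) ↔ {h v u, h u v} ∈ P.edge 2) := by
      intro v u a
      rw [← SemiGraph.card_edgeConfig G.toSemiGraph f, edgeConfig_toSemiGraph hf]
      rfl
    constructor
    · exact fun H v u a => (hr v u a).1 (H _)
    · rintro H ⟨e, he⟩
      induction e using Sym2.ind with
      | _ v u => exact (hr v u he).2 (H v u he)

theorem isSolution_output_iff (P : NodeEdgeProblem L) (A : LocalAlgorithm L) {c : ℕ}
    (N : LocalNetwork G.toSemiGraph c) :
    P.IsSolution G.toSemiGraph (A.output N) ↔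
      P.Solves G.Adj fun v u => A.out (A.stateAt N (A.time N) v) (N.prt v u) :=
  isSolution_toSemiGraph_iff P fun v u a => by
    rw [LocalAlgorithm.output, LocalNetwork.prt_of_adj a]

/-- The star with centre `none` and one edge to every element of `I`. -/
def starSemiGraph (I : Type) : SemiGraph (Option I) I where
  Inc v i := v = none ∨ v = some i
  rank_le_two i := by
    have h : {v : Option I | v = none ∨ v = some i} = {none, some i} := rfl
    rw [h]
    refine (Set.encard_insert_le _ _).trans ?_
    rw [Set.encard_singleton, one_add_one_eq_two]

/-- Every instance of the node-list variant of `P` is solvable. -/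
def ListSolvable (P : NodeEdgeProblem L) : Prop :=
  ∀ (V E : Type) [Finite V] [Finite E] (S : SemiGraph V E) (hin : V → Set (Multiset L)),
    P.IsNodeListInstance S hin → ∃ h : S.HalfEdge → L, P.IsNodeListSolution S hin h

/-- Each node of the star receives as input the completions of the configuration it already carries;
this is an instance of Π*. -/
theorem ListSolvable.exists_star {P : NodeEdgeProblem L} (hP : P.ListSolvable) {I : Type}
    [Fintype I] {ψ₀ : Multiset L} (h₀ : ψ₀ ∈ P.node ψ₀.card) {ψ : I → Multiset L}
    (hψ : ∀ i, ψ i ∈ P.node (ψ i).card) :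
    ∃ x y : I → L, Finset.univ.val.map x + ψ₀ ∈ P.node (Fintype.card I + ψ₀.card) ∧
      ∀ i, {y i} + ψ i ∈ P.node (1 + (ψ i).card) ∧ {x i, y i} ∈ P.edge 2 := by
  classical
  set S := starSemiGraph I
  have hn : ∀ i : I, S.Inc none i := fun i => .inl rfl
  have hs : ∀ i : I, S.Inc (some i) i := fun i => .inr rfl
  have hs' : ∀ i j : I, S.Inc (some i) j → j = i := fun i j h => by
    rcases h with h | h
    · cases h
    · exact (Option.some.inj h).symm
  obtain ⟨h, hnode, hedge⟩ := hP (Option I) I S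
    (fun v => v.elim (P.completions (S.degree none) ψ₀) fun i =>
      P.completions (S.degree (some i)) (ψ i)) (by
        rintro (_ | i)
        · exact ⟨_, ψ₀, h₀, rfl⟩
        · exact ⟨_, ψ i, hψ i, rfl⟩)
  refine ⟨fun i => h ⟨(none, i), hn i⟩, fun i => h ⟨(some i, i), hs i⟩, ?_, fun i => ⟨?_, ?_⟩⟩
  · have := (hnode none).2
    rw [← SemiGraph.card_nodeConfig S h] at this
    have hc : S.nodeConfig h none = Finset.univ.val.map fun i => h ⟨(none, i), hn i⟩ :=
      Multiset.map_eq_map_of_bij_of_nodup _ _ (Finset.nodup _) (Finset.nodup _)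
        (fun e _ => e.1) (fun _ _ => by simp) (fun a _ b _ hab => Subtype.ext hab)
        (fun i _ => ⟨⟨i, hn i⟩, by simp, rfl⟩) fun _ _ => rfl
    rw [hc, Multiset.card_map, Finset.card_val, Finset.card_univ] at this
    exact this
  · have := (hnode (some i)).2
    rw [← SemiGraph.card_nodeConfig S h] at this
    have hc : S.nodeConfig h (some i) = {h ⟨(some i, i), hs i⟩} := by
      have huniv : (@Finset.univ {e // S.Inc (some i) e} (Fintype.ofFinite _)) =
          {⟨i, hs i⟩} := by
        ext ⟨j, hj⟩
        simpa using hs' i j hj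
      rw [SemiGraph.nodeConfig, huniv]
      rfl
    rw [hc, Multiset.card_singleton] at this
    exact this
  · have := hedge i
    rw [← SemiGraph.card_edgeConfig S h] at this
    have hc : S.edgeConfig h i = {h ⟨(none, i), hn i⟩, h ⟨(some i, i), hs i⟩} := by
      have huniv : (@Finset.univ {v // S.Inc v i} (Fintype.ofFinite _)) =
          {⟨none, hn i⟩, ⟨some i, hs i⟩} := by
        ext ⟨v, hv⟩
        have hv : v = none ∨ v = some i := hv
        simpa using hv
      rw [SemiGraph.edgeConfig, huniv, Finset.insert_val_of_notMem (by simp),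
        Multiset.map_cons, Finset.singleton_val, Multiset.map_singleton]
      rfl
    rw [hc] at this
    exact this

/-- `x` and `y` are labels for the half-edges of a star at its centre and at its leaves, which are
indexed by the numbers at which `ψ` has a value, that extend the labels `ψ₀` at the centre and
`ψ` at the leaves. -/
def IsStarLabeling (P : NodeEdgeProblem L) (ψ₀ : Multiset L) (ψ : ℕ → Option (Multiset L))
    (xy : (ℕ → L) × (ℕ → L)) : Prop :=
  -- The only such `Q` is the support of `ψ`; quantifying over it keeps the predicate dependent on
  -- `ψ₀` and `ψ` alone.
  (∀ Q : Finset ℕ, (∀ p, p ∈ Q ↔ ψ p ≠ none) →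
      Q.val.map xy.1 + ψ₀ ∈ P.node (Q.card + ψ₀.card)) ∧
    ∀ p χ, ψ p = some χ →
      {xy.2 p} + χ ∈ P.node (1 + χ.card) ∧ {xy.1 p, xy.2 p} ∈ P.edge 2

theorem ListSolvable.exists_isStarLabeling [Nonempty L] {P : NodeEdgeProblem L}
    (hP : P.ListSolvable) {ψ₀ : Multiset L} (h₀ : ψ₀ ∈ P.node ψ₀.card)
    {ψ : ℕ → Option (Multiset L)} (hψ : ∀ p χ, ψ p = some χ → χ ∈ P.node χ.card) {Q : Finset ℕ}
    (hQ : ∀ p, p ∈ Q ↔ ψ p ≠ none) : ∃ xy, P.IsStarLabeling ψ₀ ψ xy := by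
  classical
  have hQ' : ∀ p : Q, ∃ χ, ψ p = some χ := fun p => Option.ne_none_iff_exists'.1 ((hQ p).1 p.2)
  choose χ hχ using hQ'
  obtain ⟨x, y, hx, hy⟩ := hP.exists_star h₀ (I := Q) fun p => hψ p (χ p) (hχ p)
  refine ⟨(fun p => if h : p ∈ Q then x ⟨p, h⟩ else Classical.arbitrary L,
    fun p => if h : p ∈ Q then y ⟨p, h⟩ else Classical.arbitrary L), ?_, ?_⟩
  · intro Q' hQ'
    obtain rfl : Q' = Q := by ext p; rw [hQ', hQ]
    rw [Fintype.card_coe] at hx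
    convert hx using 2
    refine Multiset.map_eq_map_of_bij_of_nodup _ _ (Finset.nodup _) (Finset.nodup _)
      (fun p hp => ⟨p, hp⟩) (fun p hp => Finset.mem_univ (⟨p, hp⟩ : Q')) (fun a _ b _ hab => congrArg Subtype.val hab)
      (fun i _ => ⟨i.1, i.2, rfl⟩)
      fun p hp => dif_pos hp
  · intro p ξ hξ
    have hp : p ∈ Q := (hQ p).2 (by rw [hξ]; simp)
    obtain rfl : χ ⟨p, hp⟩ = ξ := Option.some.inj ((hχ ⟨p, hp⟩).symm.trans hξ)
    simpa [hp] using hy ⟨p, hp⟩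

end NodeEdgeProblem

/-! ### Simulating an algorithm on a subgraph of bounded degree -/

namespace SimpleGraph

variable {V : Type} (G : SimpleGraph V)

theorem degree_toSemiGraph [Finite V] (v : V) : G.toSemiGraph.degree v = {u | G.Adj v u}.ncard := by
  classical
  have := Fintype.ofFinite V
  rw [← SemiGraph.card_nodeConfig G.toSemiGraph (fun _ => ()) v,
    NodeEdgeProblem.nodeConfig_toSemiGraph (h := fun _ _ => ()) fun _ _ _ => rfl,
    SparseNetwork.collect, Multiset.card_map, Finset.card_val, ← Set.ncard_coe_finset]
  simp

theorem underlying_toSemiGraph : G.toSemiGraph.underlying = G := by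
  ext u v
  constructor
  · rintro ⟨hne, ⟨e, he⟩, hu, hv⟩
    obtain rfl : e = s(u, v) := (Sym2.mem_and_mem_iff hne).1 ⟨hu, hv⟩
    exact he
  · exact fun h => ⟨h.ne, ⟨s(u, v), h⟩, Sym2.mem_mk_left u v, Sym2.mem_mk_right u v⟩

theorem exists_port [Finite V] (v : V) (r : V → ℕ) (hlt : ∀ u, G.Adj v u → r u < G.toSemiGraph.degree v)
    (hinj : ∀ u w, G.Adj v u → G.Adj v w → r u = r w → u = w) :
    ∃ σ : {e // G.toSemiGraph.Inc v e} ≃ Fin (G.toSemiGraph.degree v),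
      ∀ u (h : G.Adj v u), (σ ⟨⟨s(v, u), h⟩, Sym2.mem_mk_left v u⟩ : ℕ) = r u := by
  have ho : ∀ e : {e // G.toSemiGraph.Inc v e}, ∃ u, ∃ a : G.Adj v u,
      e = ⟨⟨s(v, u), a⟩, Sym2.mem_mk_left v u⟩ := by
    rintro ⟨⟨e, he⟩, hv⟩
    obtain ⟨u, rfl⟩ : ∃ u, e = s(v, u) := Sym2.mem_iff_exists.1 hv
    exact ⟨u, he, rfl⟩
  choose i hi hie using ho
  have := Fintype.ofFinite {e // G.toSemiGraph.Inc v e}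
  have hbij : Function.Bijective fun e : {e // G.toSemiGraph.Inc v e} =>
      (⟨r (i e), hlt _ (hi e)⟩ : Fin (G.toSemiGraph.degree v)) := by
    rw [Fintype.bijective_iff_injective_and_card]
    refine ⟨fun e e' h => ?_, ?_⟩
    · have h := hinj _ _ (hi e) (hi e') (congrArg Fin.val h)
      rw [hie e, hie e']
      exact Subtype.ext (Subtype.ext (congrArg (fun u => s(v, u)) h))
    · rw [Fintype.card_fin, SemiGraph.degree, Nat.card_eq_fintype_card]
  refine ⟨Equiv.ofBijective _ hbij, fun u h => ?_⟩
  have := congrArg (fun e => e.1.1) (hie ⟨⟨s(v, u), h⟩, Sym2.mem_mk_left v u⟩)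
  exact congrArg r (Sym2.congr_right.1 this).symm

end SimpleGraph

namespace SparseNetwork

variable {n c a : ℕ}

/-- The disjoint union of `H` with a complete graph of degree `D`. -/
abbrev padded {V : Type} (H : SimpleGraph V) (D : ℕ) : SimpleGraph (V ⊕ Fin (D + 1)) :=
  H ⊕g (⊤ : SimpleGraph (Fin (D + 1)))

/-- The clique attains degree D, so the simulated nodes can be told the exact underlying degree
although that of H is not locally known. -/
theorem underlyingDegree_padded {V : Type} [Finite V] {H : SimpleGraph V} {D : ℕ}
    (hD : ∀ v, {u | H.Adj v u}.ncard ≤ D) : (padded H D).toSemiGraph.underlyingDegree = D := by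
  rw [SemiGraph.underlyingDegree, SimpleGraph.underlying_toSemiGraph]
  have hr : ∀ j, ((padded H D).neighborSet (Sum.inr j)).ncard = D := by
    intro j
    have h1 : (padded H D).neighborSet (Sum.inr j) = Sum.inr '' {j}ᶜ := by
      ext (x | x)
      · simp
      · simp [eq_comm]
    rw [h1, Set.ncard_image_of_injective _ Sum.inr_injective, Set.ncard_compl]
    simp
  apply le_antisymm
  · refine ciSup_le fun v => ?_
    rcases v with v | j
    · refine le_trans (le_of_eq ?_) (hD v)
      have h1 : (padded H D).neighborSet (Sum.inl v) = Sum.inl '' {u | H.Adj v u} := by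
        ext (x | x) <;> simp
      rw [h1, Set.ncard_image_of_injective _ Sum.inl_injective]
    · exact (hr j).le
  · exact (hr 0).ge.trans (le_ciSup (f := fun v => ((padded H D).neighborSet v).ncard)
      (Set.finite_range _).bddAbove (Sum.inr 0))

theorem degree_padded_inl {V : Type} [Finite V] {H : SimpleGraph V} {D : ℕ} (v : V) :
    (padded H D).toSemiGraph.degree (Sum.inl v) = {u | H.Adj v u}.ncard := by
  rw [SimpleGraph.degree_toSemiGraph]
  have h1 : {u | (padded H D).Adj (Sum.inl v) u} = Sum.inl '' {u | H.Adj v u} := by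
    ext (x | x) <;> simp
  rw [h1, Set.ncard_image_of_injective _ Sum.inl_injective]

/-- On H, identifiers and ports are those the nodes can compute themselves. Ports in the clique are
irrelevant, as no edge joins it to H. -/
theorem exists_paddedNetwork (hc : 1 ≤ c) (M : SparseNetwork n c a) {H : SimpleGraph M.V}
    (hH : H ≤ M.G) (D : ℕ) : ∃ N' : LocalNetwork (padded H D).toSemiGraph c,
      (∀ v, N'.id (Sum.inl v) = M.N.id v) ∧
        ∀ v u, H.Adj v u → N'.prt (Sum.inl v) (Sum.inl u) = M.index H.Adj v u := by
  have hp : ∀ x : M.V ⊕ Fin (D + 1), ∃ σ : {e // (padded H D).toSemiGraph.Inc x e} ≃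
      Fin ((padded H D).toSemiGraph.degree x), ∀ v u, x = Sum.inl v →
        ∀ h : (padded H D).Adj x (Sum.inl u),
          (σ ⟨⟨s(x, Sum.inl u), h⟩, Sym2.mem_mk_left _ _⟩ : ℕ) = M.index H.Adj v u := by
    rintro (v | j)
    · obtain ⟨σ, hσ⟩ := (padded H D).exists_port (Sum.inl v)
        (Sum.elim (M.index H.Adj v) fun _ => 0) (by
          rintro (u | j) h
          · rw [degree_padded_inl]
            exact index_lt_ncard (by simpa using h)
          · simp at h) (by
          rintro (u | j) (w | j') h h' he
          · rw [index_inj (fun _ h => hH h) (by simpa using h) (by simpa using h') he]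
          all_goals simp at h h')
      refine ⟨σ, ?_⟩
      rintro v' u he h
      obtain rfl := Sum.inl_injective he
      exact hσ _ h
    · exact ⟨Finite.equivFinOfCardEq rfl, fun v u h => nomatch h⟩
  choose σ hσ using hp
  -- Room for the identifiers of the clique, which follow directly after n^c.
  have hpow : Nat.card M.V ^ c + (D + 1) ≤ (Nat.card (M.V ⊕ Fin (D + 1))) ^ c := by
    rw [Nat.card_sum, Nat.card_eq_fintype_card (α := Fin _), Fintype.card_fin]
    obtain ⟨k, rfl⟩ := Nat.exists_eq_add_of_le' hc
    set m := Nat.card M.V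
    calc m ^ (k + 1) + (D + 1) ≤ m ^ k * m + (m + (D + 1)) ^ k * (D + 1) := by
          rw [pow_succ]
          exact Nat.add_le_add_left (Nat.le_mul_of_pos_left _ (by positivity)) _
      _ ≤ (m + (D + 1)) ^ k * m + (m + (D + 1)) ^ k * (D + 1) := by gcongr; omega
      _ = _ := by ring
  refine ⟨⟨Sum.elim M.N.id fun j => Nat.card M.V ^ c + 1 + j, ?_, ?_, ?_, σ⟩,
    fun _ => rfl, fun v u h => ?_⟩
  · rintro (v | j) (v' | j') h
    · exact congrArg _ (M.N.id_injective h)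
    · have := M.N.id_le v
      simp only [Sum.elim_inl, Sum.elim_inr] at h
      omega
    · have := M.N.id_le v'
      simp only [Sum.elim_inl, Sum.elim_inr] at h
      omega
    · simp only [Sum.elim_inr] at h
      exact congrArg _ (Fin.ext (by omega))
  · rintro (v | j)
    · exact M.N.one_le_id v
    · simp only [Sum.elim_inr]; omega
  · rintro (v | j)
    · exact (M.N.id_le v).trans (le_trans (Nat.le_add_right _ _) hpow)
    · have := j.2
      simp only [Sum.elim_inr]
      omega
  · have h' : (padded H D).Adj (Sum.inl v) (Sum.inl u) := by simpa using h
    rw [LocalNetwork.prt_of_adj h']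
    exact hσ _ _ _ rfl h'

section

variable {L : Type u} (A : LocalAlgorithm L) (hc : 1 ≤ c)
  {H : ∀ M : SparseNetwork n c a, SimpleGraph M.V} (hH : ∀ M, H M ≤ M.G) (D : ℕ)

/-- The network on `H M` padded by a complete graph of degree `D`. -/
noncomputable def paddedNetwork (M : SparseNetwork n c a) :
    LocalNetwork (padded (H M) D).toSemiGraph c :=
  (exists_paddedNetwork hc M (hH M) D).choose

theorem paddedNetwork_id (M : SparseNetwork n c a) (v : M.V) :
    (paddedNetwork hc hH D M).id (Sum.inl v) = M.N.id v :=
  (exists_paddedNetwork hc M (hH M) D).choose_spec.1 v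

theorem paddedNetwork_prt {M : SparseNetwork n c a} {v u : M.V} (h : (H M).Adj v u) :
    (paddedNetwork hc hH D M).prt (Sum.inl v) (Sum.inl u) = M.index (H M).Adj v u :=
  (exists_paddedNetwork hc M (hH M) D).choose_spec.2 v u h

theorem card_padded (M : SparseNetwork n c a) : Nat.card (M.V ⊕ Fin (D + 1)) = n + (D + 1) := by
  rw [Nat.card_sum, M.card_eq, Nat.card_eq_fintype_card, Fintype.card_fin]

variable {hc hH D}

theorem inbox_padded {M : SparseNetwork n c a} {st : M.V ⊕ Fin (D + 1) → A.State} {v u : M.V}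
    (h : (H M).Adj v u) :
    A.inbox (paddedNetwork hc hH D M) st (Sum.inl v) (M.index (H M).Adj v u) =
      some (A.send (st (Sum.inl u)) (M.index (H M).Adj u v)) := by
  rw [← paddedNetwork_prt hc hH D h, ← paddedNetwork_prt hc hH D h.symm]
  exact LocalAlgorithm.inbox_prt _ _ (by simpa using h)

theorem inbox_padded_eq_none {M : SparseNetwork n c a} {st : M.V ⊕ Fin (D + 1) → A.State}
    {v : M.V} {p : ℕ} (h : ∀ u, (H M).Adj v u → M.index (H M).Adj v u ≠ p) :
    A.inbox (paddedNetwork hc hH D M) st (Sum.inl v) p = none := by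
  refine LocalAlgorithm.inbox_eq_none _ _ ?_
  rintro (u | j) hu
  · have hu : (H M).Adj v u := by simpa using hu
    rw [paddedNetwork_prt hc hH D hu]
    exact h u hu
  · simp at hu

/-- Edges of H are edges of G, so a simulated round costs one real round. A message depends on the
simulated state of the neighbour and on its index for the shared edge. -/
theorem Known.stateAt_padded {t : ℕ} (hK : KnownAt t fun M => (H M).Adj)
    (hD : ∀ M v, {u | (H M).Adj v u}.ncard ≤ D) (s : ℕ) :
    Known (t + s) fun M v => A.stateAt (paddedNetwork hc hH D M) s (Sum.inl v) := by
  have hidx := hK.index fun M _ _ h => hH M h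
  induction s with
  | zero =>
    intro M M' v v' hv
    simp only [LocalAlgorithm.stateAt, card_padded, underlyingDegree_padded (hD _),
      paddedNetwork_id, degree_padded_inl]
    have hd := (KnownAt.ncard hK fun M _ _ h => hH M h) _ _ _ _ hv
    beta_reduce at hd
    rw [id_eq_of_view_eq hv, hd]
  | succ s ih =>
    intro M M' v v' hv
    have hv' := view_eq_of_le (Nat.le_succ _) hv
    have hv0 := view_eq_of_le (Nat.le_add_right t (s + 1)) hv
    simp only [LocalAlgorithm.stateAt]
    have hst := ih _ _ _ _ hv'
    beta_reduce at hst
    rw [hst]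
    congr 1
    funext p
    by_cases h : ∃ u, (H M).Adj v u ∧ M.index (H M).Adj v u = p
    · obtain ⟨u, hu, rfl⟩ := h
      obtain ⟨u', ha, hp⟩ := exists_adj_of_view_eq hv (hH M hu)
      have hu' : (H M').Adj v' u' := (hK _ _ _ _ _ _ hv0 (hH M hu) ha hp.symm).mp hu
      obtain ⟨h1, h2⟩ := view_adj hv (hH M hu) ha hp.symm
      have hi := hidx _ _ _ _ _ _ hv0 (hH M hu) ha hp.symm
      have hst' := ih _ _ _ _ h1
      have hi' := hidx _ _ _ _ _ _ (view_eq_of_le (Nat.le_add_right t s) h1) (hH M hu).symm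
        ha.symm h2
      beta_reduce at hi hst' hi'
      rw [inbox_padded A hu, hi, inbox_padded A hu', hst', hi']
    · rw [inbox_padded_eq_none A fun u h1 h2 => h ⟨u, h1, h2⟩, inbox_padded_eq_none]
      rintro u' hu' rfl
      obtain ⟨u, ha, hp⟩ := exists_adj_of_view_eq hv.symm (hH M' hu')
      have hu : (H M).Adj v u := (hK _ _ _ _ _ _ hv0 ha (hH M' hu') hp).mpr hu'
      exact h ⟨u, hu, hidx _ _ _ _ _ _ hv0 ha (hH M' hu') hp⟩

variable (hc hH D)

/-- The labels that the simulated algorithm puts on the edges of `H M` after `s` rounds. -/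
noncomputable def paddedLabel (s : ℕ) (M : SparseNetwork n c a) (v u : M.V) : L :=
  A.out (A.stateAt (paddedNetwork hc hH D M) s (Sum.inl v)) (M.index (H M).Adj v u)

variable {hc hH D}

theorem KnownAt.paddedLabel {t : ℕ} (hK : KnownAt t fun M => (H M).Adj)
    (hD : ∀ M v, {u | (H M).Adj v u}.ncard ≤ D) (s : ℕ) :
    KnownAt (t + s) (SparseNetwork.paddedLabel A hc hH D s) :=
  ((Known.stateAt_padded A hK hD s).knownAt.prod
    ((hK.index fun M _ _ h => hH M h).mono (Nat.le_add_right t s))).map fun x : A.State × ℕ => A.out x.1 x.2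

/-- The clique is a separate component, so a solution on the padded graph restricts to H. -/
theorem solves_paddedLabel {P : NodeEdgeProblem L} {M : SparseNetwork n c a}
    (hA : P.IsSolution (padded (H M) D).toSemiGraph (A.output (paddedNetwork hc hH D M))) :
    P.Solves (H M).Adj (SparseNetwork.paddedLabel A hc hH D
      (A.time (paddedNetwork hc hH D M)) M) := by
  classical
  rw [NodeEdgeProblem.isSolution_output_iff] at hA
  have he : ∀ v u, (H M).Adj v u → SparseNetwork.paddedLabel A hc hH D
      (A.time (paddedNetwork hc hH D M)) M v u = A.out (A.stateAt (paddedNetwork hc hH D M)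
        (A.time (paddedNetwork hc hH D M)) (Sum.inl v))
        ((paddedNetwork hc hH D M).prt (Sum.inl v) (Sum.inl u)) := by
    intro v u h
    rw [paddedNetwork_prt hc hH D h]
    rfl
  constructor
  · intro v
    refine (congrArg (fun m => m ∈ P.node m.card) (?_ : _ = collect _ _ _)).mpr
      (hA.1 (Sum.inl v))
    refine Multiset.map_eq_map_of_bij_of_nodup _ _ (Finset.nodup _) (Finset.nodup _)
      (fun u _ => Sum.inl u) ?_ ?_ ?_ ?_
    · intro u hu
      simpa using hu
    · exact fun _ _ _ _ h => Sum.inl_injective h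
    · rintro (u | j) hu
      · exact ⟨u, by simpa using hu, rfl⟩
      · simp at hu
    · intro u hu
      exact he v u (by simpa using hu)
  · intro v u h
    rw [he v u h, he u v h.symm]
    exact hA.2 (Sum.inl v) (Sum.inl u) (by simpa using h)

end

end SparseNetwork

/-! ### Extending partial solutions over stars -/

namespace SparseNetwork

variable {n c a : ℕ} {L : Type u}

theorem collect_eq {X : Type*} {V : Type} [Fintype V] {R : V → V → Prop} {h : V → V → X} {v : V}
    {Q : Finset V} (hQ : ∀ u, u ∈ Q ↔ R v u) : collect R h v = Q.val.map (h v) := by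
  classical
  rw [collect]
  congr 2
  ext u
  simp [hQ]

section

variable [Nonempty L] (P : NodeEdgeProblem L)

/-- The labels that the centre `v` of a star chooses for its ports and for the leaves behind them,
where `R` are the edges labeled so far by `h`, and `C u v` means that `u` is a leaf at `v`. -/
noncomputable def starLabels (M : SparseNetwork n c a) (R C : M.V → M.V → Prop)
    (h : M.V → M.V → L) (v : M.V) : (ℕ → L) × (ℕ → L) :=
  Classical.epsilon (P.IsStarLabeling (collect R h v)
    (M.byPort (fun v u => C u v) (fun _ u => collect R h u) v))

open Classical in
/-- The labeling `h` extended to the stars given by `C`. -/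
noncomputable def extendToStars (M : SparseNetwork n c a) (R C : M.V → M.V → Prop)
    (h : M.V → M.V → L) (v u : M.V) : L :=
  if C u v then (M.starLabels P R C h v).1 (M.prt v u)
  else if C v u then (M.starLabels P R C h u).2 (M.prt u v)
  else h v u

/-- One round brings the configurations of the leaves to the centre, another returns their labels.
The `epsilon` choice is a function of data the centre knows, so equal views yield equal labels. -/
theorem KnownAt.extendToStars {t : ℕ} {R C : ∀ M : SparseNetwork n c a, M.V → M.V → Prop}
    {h : ∀ M : SparseNetwork n c a, M.V → M.V → L} (hR : KnownAt t R) (hh : KnownAt t h)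
    (hC : KnownAt t C) (hC' : KnownAt t fun M v u => C M u v)
    (hadj : ∀ M v u, R M v u → M.G.Adj v u) :
    KnownAt (t + 2) fun M => M.extendToStars P (R M) (C M) (h M) := by
  have h1 : Known t fun M v => SparseNetwork.collect (R M) (h M) v := hR.collect hh hadj
  have h2 : Known (t + 1) fun M v => M.byPort (fun v u => C M u v)
      (fun _ u => SparseNetwork.collect (R M) (h M) u) v := (hC'.mono (Nat.le_succ t)).byPort h1.nbr
  have h3 : Known (t + 1) fun M v => M.starLabels P (R M) (C M) (h M) v :=
    ((h1.mono (Nat.le_succ t)).prod h2).map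
      fun x : Multiset L × (ℕ → Option (Multiset L)) =>
        Classical.epsilon (P.IsStarLabeling x.1 x.2)
  have h4 : KnownAt (t + 1) fun M v u => (M.starLabels P (R M) (C M) (h M) v).1 (M.prt v u) :=
    (h3.knownAt.prod KnownAt.prt).map fun x : ((ℕ → L) × (ℕ → L)) × ℕ => x.1.1 x.2
  have h5 : KnownAt (t + 1) fun M v u => (M.starLabels P (R M) (C M) (h M) v).2 (M.prt v u) :=
    (h3.knownAt.prod KnownAt.prt).map fun x : ((ℕ → L) × (ℕ → L)) × ℕ => x.1.2 x.2
  intro M M' v u v' u' hv ha ha' hp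
  have hvt := view_eq_of_le (Nat.le_add_right t 2) hv
  have e1 := hC' _ _ _ _ _ _ hvt ha ha' hp
  have e2 := hC _ _ _ _ _ _ hvt ha ha' hp
  have e3 := h4.mono (Nat.le_succ _) _ _ _ _ _ _ hv ha ha' hp
  have e4 := h5.swap _ _ _ _ _ _ hv ha ha' hp
  have e5 := hh _ _ _ _ _ _ hvt ha ha' hp
  beta_reduce at e1 e2 e3 e4
  simp only [SparseNetwork.extendToStars, e3, e4, e5]
  classical
  exact if_congr (iff_of_eq e1) rfl (if_congr (iff_of_eq e2) rfl rfl)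

variable {P} in
-- The conditions on C say that it consists of disjoint stars with edges outside R: a leaf has one
-- centre, and no node is both leaf and centre.
theorem solves_extendToStars (hP : P.ListSolvable) {M : SparseNetwork n c a}
    {R C : M.V → M.V → Prop} {h : M.V → M.V → L} (hs : P.Solves R h)
    (hC : ∀ u v, C u v → M.G.Adj u v) (hout : ∀ u v w, C u v → C u w → v = w)
    (hstar : ∀ u v w, C u v → ¬ C w u) (hdisj : ∀ u v, R u v → ¬ C u v ∧ ¬ C v u) :
    P.Solves (fun v u => R v u ∨ C v u ∨ C u v) (M.extendToStars P R C h) := by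
  classical
  set h' := M.extendToStars P R C h with hh'
  set ψ := fun v => collect R h v with hψ
  have hpick : ∀ v, P.IsStarLabeling (ψ v) (M.byPort (fun v u => C u v) (fun _ u => ψ u) v)
      (M.starLabels P R C h v) := by
    intro v
    refine Classical.epsilon_spec (hP.exists_isStarLabeling (hs.1 v) ?_
      (Q := (Finset.univ.filter fun u => C u v).image (M.prt v)) ?_)
    · intro p χ hχ
      by_cases hp : ∃ u, M.G.Adj v u ∧ M.prt v u = p ∧ C u v
      · obtain ⟨u, hu, rfl, hcu⟩ := hp
        rw [byPort_prt hu hcu] at hχ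
        obtain rfl := Option.some.inj hχ
        exact hs.1 u
      · rw [byPort_eq_none fun u h1 h2 h3 => hp ⟨u, h1, h2, h3⟩] at hχ
        cases hχ
    · intro p
      simp only [Finset.mem_image, Finset.mem_filter, Finset.mem_univ, true_and]
      constructor
      · rintro ⟨u, hu, rfl⟩
        rw [byPort_prt (hC _ _ hu).symm hu]
        simp
      · intro hne
        by_contra hcon
        exact hne (byPort_eq_none fun u _ h2 h3 => hcon ⟨u, h3, h2⟩)
  have hmem : ∀ u v, C u v → {(M.starLabels P R C h v).2 (M.prt v u)} + ψ u ∈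
      P.node (1 + (ψ u).card) ∧ {(M.starLabels P R C h v).1 (M.prt v u),
        (M.starLabels P R C h v).2 (M.prt v u)} ∈ P.edge 2 := fun u v hcu =>
    (hpick v).2 _ _ (byPort_prt (hC _ _ hcu).symm hcu)
  have hin : ∀ u v, C u v → h' v u = (M.starLabels P R C h v).1 (M.prt v u) :=
    fun u v hcu => if_pos hcu
  have hleaf : ∀ u v, C u v → h' u v = (M.starLabels P R C h v).2 (M.prt v u) :=
    fun u v hcu => (if_neg (hstar u v v hcu)).trans (if_pos hcu)
  have hold : ∀ u v, R u v → h' u v = h u v := fun u v hr =>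
    (if_neg (hdisj u v hr).2).trans (if_neg (hdisj u v hr).1)
  refine ⟨fun v => ?_, fun v u hvu => ?_⟩
  -- Either v is a leaf and gains exactly one edge, or all its new edges, possibly none, come from
  -- leaves.
  · by_cases hv : ∃ w, C v w
    · obtain ⟨w, hw⟩ := hv
      have hf : ∀ u, u ∈ insert w (Finset.univ.filter (R v)) ↔ R v u ∨ C v u ∨ C u v := by
        intro u
        simp only [Finset.mem_filter, Finset.mem_univ, true_and, Finset.mem_insert]
        constructor
        · rintro (rfl | h)
          · exact .inr (.inl hw)
          · exact .inl h
        · rintro (h | h | h)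
          · exact .inr h
          · exact .inl (hout _ _ _ h hw)
          · exact absurd h (hstar _ _ _ hw)
      have hc : collect (fun v u => R v u ∨ C v u ∨ C u v) h' v = {h' v w} + ψ v := by
        rw [collect_eq hf, Finset.insert_val_of_notMem, Multiset.map_cons,
          ← Multiset.singleton_add]
        · congr 1
          exact Multiset.map_congr rfl fun u hu => hold v u (by simpa using hu)
        · simp only [Finset.mem_filter, Finset.mem_univ, true_and]
          exact fun h => (hdisj _ _ h).1 hw
      rw [hc, Multiset.card_add, Multiset.card_singleton, hleaf v w hw]
      exact (hmem v w hw).1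
    · push Not at hv
      have hd : Disjoint (Finset.univ.filter fun u => C u v) (Finset.univ.filter (R v)) := by
        rw [Finset.disjoint_left]
        intro u hu hu'
        exact (hdisj v u (by simpa using hu')).2 (by simpa using hu)
      have hf : ∀ u, u ∈ (Finset.univ.filter fun u => C u v).disjUnion
          (Finset.univ.filter (R v)) hd ↔ R v u ∨ C v u ∨ C u v := by
        intro u
        simp only [Finset.mem_filter, Finset.mem_univ, true_and, Finset.mem_disjUnion, hv u,
          false_or]
        exact or_comm
      have hc : collect (fun v u => R v u ∨ C v u ∨ C u v) h' v =
          ((Finset.univ.filter fun u => C u v).image (M.prt v)).val.map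
            (M.starLabels P R C h v).1 + ψ v := by
        rw [collect_eq hf, Finset.disjUnion_val, Multiset.map_add, Finset.image_val_of_injOn,
          Multiset.map_map]
        · congr 1
          · exact Multiset.map_congr rfl fun u hu => hin u v (by simpa using hu)
          · exact Multiset.map_congr rfl fun u hu => hold v u (by simpa using hu)
        · intro u hu w hw he
          simp only [Finset.coe_filter, Finset.mem_univ, true_and, Set.mem_ofPred_eq] at hu hw
          exact LocalNetwork.prt_inj (N := M.N) (hC _ _ hu).symm (hC _ _ hw).symm he
      rw [hc, Multiset.card_add, Multiset.card_map, Finset.card_val]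
      refine (hpick v).1 _ fun p => ?_
      simp only [Finset.mem_image, Finset.mem_filter, Finset.mem_univ, true_and]
      constructor
      · rintro ⟨u, hu, rfl⟩
        rw [byPort_prt (hC _ _ hu).symm hu]
        simp
      · intro hne
        by_contra hcon
        exact hne (byPort_eq_none fun u _ h2 h3 => hcon ⟨u, h3, h2⟩)
  · rcases hvu with hr | hc | hc
    · have e2 : h' u v = h u v := (if_neg (hdisj v u hr).1).trans (if_neg (hdisj v u hr).2)
      rw [hold v u hr, e2]
      exact hs.2 v u hr
    · rw [hleaf v u hc, hin v u hc, Multiset.pair_comm]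
      exact (hmem v u hc).2
    · rw [hleaf u v hc, hin u v hc]
      exact (hmem u v hc).2

end

/-! ### The decomposition is locally determined -/

section

variable {K b t : ℕ}

theorem KnownAt.adj : KnownAt t fun (M : SparseNetwork n c a) => M.G.Adj :=
  fun _ _ _ _ _ _ _ h h' _ => propext ⟨fun _ => h', fun _ => h⟩

theorem Known.degIn {S : ∀ M : SparseNetwork n c a, Set M.V} (h : Known t fun M v => v ∈ S M) :
    Known (t + 1) fun M v => M.G.degIn (S M) v :=
  ((KnownAt.adj.prod h.nbr).map fun x : Prop × Prop => x.1 ∧ x.2).ncard fun _ _ _ h => h.1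

/-- A stage takes two rounds: one to learn the current degree, one to count neighbours of degree
above K. -/
theorem Known.remaining (i : ℕ) :
    Known (2 * i) fun (M : SparseNetwork n c a) v => v ∈ M.G.remaining K b i := by
  induction i with
  | zero => exact Known.const _
  | succ i ih =>
    have h1 := ih.degIn
    have h2 : Known (2 * i + 1) fun (M : SparseNetwork n c a) v =>
        v ∈ {u | u ∈ M.G.remaining K b i ∧ K < M.G.degIn (M.G.remaining K b i) u} :=
      ((ih.mono (Nat.le_succ _)).prod h1).map fun x : Prop × ℕ => x.1 ∧ K < x.2
    exact ((ih.mono (by omega)).prod ((h1.mono (Nat.le_succ _)).prod h2.degIn)).map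
      fun x : Prop × ℕ × ℕ => x.1 ∧ ¬ (x.2.1 ≤ K ∧ x.2.2 ≤ b)

variable {T : ℕ}

/-- Both ends of an edge learn its orientation. Stages after T are empty, so 2T rounds determine
membership in all stages at once. -/
theorem KnownAt.atypical
    (hT : ∀ M : SparseNetwork n c a, M.G.remaining K b T = ∅) :
    KnownAt (2 * T + 2) (fun (M : SparseNetwork n c a) => M.G.Atypical K b) ∧
      KnownAt (2 * T + 2) fun (M : SparseNetwork n c a) v u => M.G.Atypical K b u v := by
  have h1 : ∀ i, Known (2 * T) fun (M : SparseNetwork n c a) v => v ∈ M.G.remaining K b i := by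
    intro i
    rcases le_total i T with hi | hi
    · exact (Known.remaining i).mono (by omega)
    · have : ∀ M : SparseNetwork n c a, M.G.remaining K b i = ∅ := fun M =>
        Set.subset_empty_iff.1 ((hT M).subset.trans' (SimpleGraph.remaining_anti hi))
      simp only [this]
      exact Known.const _
  have h2 := Known.pi h1
  have h3 := (Known.pi fun i => (h1 i).degIn).nbr
  have h4 := (Known.pi fun i => (h1 i).degIn).knownAt
  have h2' := (h2.mono (by omega : 2 * T ≤ 2 * T + 2)).knownAt
  have h2'' := h2.nbr.mono (by omega : 2 * T + 1 ≤ 2 * T + 2)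
  have h4' := h4.mono (by omega : 2 * T + 1 ≤ 2 * T + 2)
  constructor
  · exact (KnownAt.adj.prod ((h2'.prod h2'').prod h3)).map
      fun x : Prop × ((ℕ → Prop) × (ℕ → Prop)) × (ℕ → ℕ) =>
        x.1 ∧ ∃ i, x.2.1.1 i ∧ ¬ x.2.1.1 (i + 1) ∧ x.2.1.2 i ∧ K < x.2.2 i
  · have := (KnownAt.adj.prod ((h2''.prod h2').prod h4')).map
      fun x : Prop × ((ℕ → Prop) × (ℕ → Prop)) × (ℕ → ℕ) =>
        x.1 ∧ ∃ i, x.2.1.1 i ∧ ¬ x.2.1.1 (i + 1) ∧ x.2.1.2 i ∧ K < x.2.2 i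
    intro M M' v u v' u' hv ha ha' hp
    have e := this _ _ _ _ _ _ hv ha ha' hp
    beta_reduce at e
    simp only [SimpleGraph.Atypical, M.G.adj_comm u v, M'.G.adj_comm u' v']
    exact e

theorem KnownAt.typical (hT : ∀ M : SparseNetwork n c a, M.G.remaining K b T = ∅) :
    KnownAt (2 * T + 2) fun (M : SparseNetwork n c a) => (M.G.typical K b).Adj :=
  (KnownAt.adj.prod ((KnownAt.atypical hT).1.prod (KnownAt.atypical hT).2)).map
    fun x : Prop × Prop × Prop => x.1 ∧ ¬ x.2.1 ∧ ¬ x.2.2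

end

/-! ### Colouring the forests of atypical edges -/

section

variable (K b : ℕ)

/-- The number of the forest that contains an atypical edge. -/
noncomputable def forestIndex (M : SparseNetwork n c a) (u v : M.V) : ℕ :=
  M.index (M.G.Atypical K b) u v

/-- The colour of `u` in the forest with number `i` after `s` rounds. -/
def forestColor (M : SparseNetwork n c a) : ℕ → ℕ → M.V → Prop
  | 0 => fun _ _ => False
  | s + 1 => fun i u => ∃ v, (M.G.Atypical K b u v ∧ M.forestIndex K b u v = i) ∧
      ¬ M.forestColor s i v

open Classical in
/-- The number of the star class that contains an atypical edge. -/
noncomputable def starIndex (M : SparseNetwork n c a) (T : ℕ) (u v : M.V) : ℕ :=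
  2 * M.forestIndex K b u v + if M.forestColor K b T (M.forestIndex K b u v) v then 1 else 0

variable {K b} {T : ℕ} {M : SparseNetwork n c a} {u v w : M.V}

theorem forestIndex_inj (hv : M.G.Atypical K b u v) (hw : M.G.Atypical K b u w)
    (h : M.forestIndex K b u v = M.forestIndex K b u w) : v = w :=
  index_inj (fun _ h => h.1) hv hw h

theorem forestColor_succ_iff (hv : M.G.Atypical K b u v) (s : ℕ) :
    M.forestColor K b (s + 1) (M.forestIndex K b u v) u ↔
      ¬ M.forestColor K b s (M.forestIndex K b u v) v := by
  constructor
  · rintro ⟨w, ⟨hw, hi⟩, h⟩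
    obtain rfl := forestIndex_inj hw hv hi
    exact h
  · exact fun h => ⟨v, ⟨hv, rfl⟩, h⟩

/-- Each parent step leads to a later stage, so the parent path from a node present after j stages
has fewer than T - j edges, and m = T - j updates settle its colour. -/
theorem forestColor_stable (hT : M.G.remaining K b T = ∅) (i m j : ℕ) (hmj : m + j = T) {u : M.V}
    (hu : u ∈ M.G.remaining K b j) {s : ℕ} (hs : m ≤ s) :
    M.forestColor K b s i u ↔ M.forestColor K b m i u := by
  induction m generalizing j u s with
  | zero =>
    obtain rfl : j = T := by omega
    rw [hT] at hu
    exact hu.elim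
  | succ m ih =>
    obtain ⟨s, rfl⟩ := Nat.exists_eq_add_of_le' (Nat.one_le_of_lt hs)
    refine exists_congr fun v => and_congr_right fun hv => not_congr ?_
    exact ih (j + 1) (by omega) (hv.1.mem_succ hu) (by omega)

theorem forestColor_iff (hT : M.G.remaining K b T = ∅) (hv : M.G.Atypical K b u v) :
    M.forestColor K b T (M.forestIndex K b u v) u ↔
      ¬ M.forestColor K b T (M.forestIndex K b u v) v := by
  rw [← forestColor_succ_iff hv]
  exact (forestColor_stable hT _ T 0 rfl (u := u) trivial (Nat.le_succ T)).symm

theorem starIndex_lt (hv : M.G.Atypical K b u v) : M.starIndex K b T u v < 2 * b := by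
  have h1 : M.forestIndex K b u v < b := (index_lt_ncard hv).trans_le (SimpleGraph.ncard_atypical_le u)
  unfold starIndex
  split_ifs <;> omega

theorem forestIndex_eq_of_starIndex_eq {u' v' : M.V}
    (h : M.starIndex K b T u v = M.starIndex K b T u' v') :
    M.forestIndex K b u v = M.forestIndex K b u' v' := by
  unfold starIndex at h
  split_ifs at h <;> omega

theorem starIndex_inj (hv : M.G.Atypical K b u v) (hw : M.G.Atypical K b u w)
    (h : M.starIndex K b T u v = M.starIndex K b T u w) : v = w :=
  forestIndex_inj hv hw (forestIndex_eq_of_starIndex_eq h)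

/-- The last bit of the star index is the colour of the head. Within a class all heads share one
colour and all tails have the other, so no node is both. -/
theorem starIndex_ne (hT : M.G.remaining K b T = ∅) (hv : M.G.Atypical K b u v) :
    M.starIndex K b T u v ≠ M.starIndex K b T w u := by
  intro h
  have hi := forestIndex_eq_of_starIndex_eq h
  have hc := forestColor_iff hT hv
  unfold starIndex at h
  rw [← hi] at h
  split_ifs at h with h1 h2 <;> first | omega | tauto

/-- The cost is 2T + 2 rounds for orientation and forest numbers, T for the colours, and one to
learn the colour of the head. -/
theorem KnownAt.starIndex (hT : ∀ M : SparseNetwork n c a, M.G.remaining K b T = ∅) :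
    KnownAt (3 * T + 3) fun (M : SparseNetwork n c a) => M.starIndex K b T := by
  have hA := (KnownAt.atypical hT).1
  have hidx : KnownAt (2 * T + 2) fun (M : SparseNetwork n c a) => M.forestIndex K b :=
    hA.index fun _ _ _ h => h.1
  have hcol : ∀ s i, Known (2 * T + 2 + s)
      fun (M : SparseNetwork n c a) => M.forestColor K b s i := by
    intro s i
    induction s with
    | zero => exact Known.const _
    | succ s ih =>
      have h := ((((hA.prod hidx).mono (by omega : _ ≤ 2 * T + 2 + (s + 1))).prod ih.nbr).map
        fun x : (Prop × ℕ) × Prop => (x.1.1 ∧ x.1.2 = i) ∧ ¬ x.2).ncard fun _ _ _ h => h.1.1.1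
      have h' := h.map fun x => x ≠ 0
      have he : ∀ (M : SparseNetwork n c a) u, M.forestColor K b (s + 1) i u =
          ({v | (M.G.Atypical K b u v ∧ M.forestIndex K b u v = i) ∧
            ¬ M.forestColor K b s i v}.ncard ≠ 0) := by
        intro M u
        rw [ne_eq, Set.ncard_eq_zero, ← ne_eq, ← Set.nonempty_iff_ne_empty]
        rfl
      intro M M' v v' hv
      exact (he M v).trans ((h' _ _ _ _ hv).trans (he M' v').symm)
  have hcol' := (Known.pi (hcol T)).nbr
  classical
  exact (((hidx.mono (by omega)).prod hcol').mono (by omega : 2 * T + 2 + T + 1 ≤ _)).map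
    fun x : ℕ × (ℕ → Prop) => 2 * x.1 + if x.2 x.1 then 1 else 0

end

/-! ### The solution -/

section

variable [Nonempty L] (P : NodeEdgeProblem L) (K b T : ℕ)

/-- The atypical edges of a star class. -/
def StarClass (s : ℕ) (M : SparseNetwork n c a) (u v : M.V) : Prop :=
  M.G.Atypical K b u v ∧ M.starIndex K b T u v = s

/-- The typical edges and the edges in the first star classes. -/
def PartialAdj (M : SparseNetwork n c a) : ℕ → M.V → M.V → Prop
  | 0 => (M.G.typical K b).Adj
  | s + 1 => fun v u => M.PartialAdj s v u ∨ M.StarClass K b T s v u ∨ M.StarClass K b T s u v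

/-- A labeling of the typical edges, extended to the first star classes. -/
noncomputable def extendedLabel (M : SparseNetwork n c a) (h : M.V → M.V → L) :
    ℕ → M.V → M.V → L
  | 0 => h
  | s + 1 => M.extendToStars P (M.PartialAdj K b T s) (M.StarClass K b T s) (M.extendedLabel h s)

variable {P K b T}

theorem partialAdj_iff {M : SparseNetwork n c a} {s : ℕ} {v u : M.V} :
    M.PartialAdj K b T s v u ↔ (M.G.typical K b).Adj v u ∨
      (M.G.Atypical K b v u ∧ M.starIndex K b T v u < s) ∨
      (M.G.Atypical K b u v ∧ M.starIndex K b T u v < s) := by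
  induction s with
  | zero => simp [PartialAdj]
  | succ s ih =>
    show M.PartialAdj K b T s v u ∨ M.StarClass K b T s v u ∨ M.StarClass K b T s u v ↔ _
    rw [ih, StarClass, StarClass]
    simp only [Nat.lt_succ_iff_lt_or_eq]
    tauto

theorem partialAdj_eq_adj (M : SparseNetwork n c a) :
    M.PartialAdj K b T (2 * b) = M.G.Adj := by
  funext v u
  rw [eq_iff_iff, partialAdj_iff]
  constructor
  · rintro (h | h | h)
    · exact h.1
    · exact h.1.1
    · exact h.1.1.symm
  · intro h
    by_cases h1 : M.G.Atypical K b v u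
    · exact .inr (.inl ⟨h1, starIndex_lt h1⟩)
    · by_cases h2 : M.G.Atypical K b u v
      · exact .inr (.inr ⟨h2, starIndex_lt h2⟩)
      · exact .inl ⟨h, h1, h2⟩

theorem solves_extendedLabel (hP : P.ListSolvable) {M : SparseNetwork n c a}
    (hT : M.G.remaining K b T = ∅) {h : M.V → M.V → L}
    (hh : P.Solves (M.G.typical K b).Adj h) (s : ℕ) :
    P.Solves (M.PartialAdj K b T s) (M.extendedLabel P K b T h s) := by
  induction s with
  | zero => exact hh
  | succ s ih =>
    refine solves_extendToStars hP ih (fun u v h => h.1.1)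
      (fun u v w h h' => starIndex_inj h.1 h'.1 (h.2.trans h'.2.symm))
      (fun u v w h h' => starIndex_ne hT h.1 (h.2.trans h'.2.symm)) fun u v hr => ?_
    have key : ∀ u v, M.PartialAdj K b T s u v → ¬ M.StarClass K b T s u v := by
      rintro u v hr ⟨h1, h2⟩
      rcases partialAdj_iff.1 hr with h | h | h
      · exact h.2.1 h1
      · exact h.2.ne h2
      · exact h1.asymm hT h.1
    refine ⟨key u v hr, key v u ?_⟩
    rw [partialAdj_iff] at hr ⊢
    rw [SimpleGraph.adj_comm]
    tauto

theorem KnownAt.extendedLabel (hT : ∀ M : SparseNetwork n c a, M.G.remaining K b T = ∅) {t : ℕ}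
    (ht : 3 * T + 4 ≤ t) {h : ∀ M : SparseNetwork n c a, M.V → M.V → L} (hh : KnownAt t h)
    (s : ℕ) :
    KnownAt (t + 2 * s) fun M => SparseNetwork.extendedLabel P K b T M (h M) s := by
  obtain ⟨h1, h2⟩ := KnownAt.atypical hT
  have h3 := KnownAt.starIndex hT
  have hC : ∀ s, KnownAt t (fun (M : SparseNetwork n c a) => M.StarClass K b T s) := fun s =>
    ((h1.mono (by omega)).prod (h3.mono (by omega))).map fun x : Prop × ℕ => x.1 ∧ x.2 = s
  have hC' : ∀ s, KnownAt t (fun (M : SparseNetwork n c a) v u => M.StarClass K b T s u v) :=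
    fun s => ((h2.mono (by omega)).prod (h3.swap.mono (by omega))).map
      fun x : Prop × ℕ => x.1 ∧ x.2 = s
  have hR : ∀ s, KnownAt t (fun (M : SparseNetwork n c a) => M.PartialAdj K b T s) := by
    intro s
    induction s with
    | zero => exact (KnownAt.typical hT).mono (by omega)
    | succ s ih =>
      exact (ih.prod ((hC s).prod (hC' s))).map fun x : Prop × Prop × Prop => x.1 ∨ x.2.1 ∨ x.2.2
  induction s with
  | zero => exact hh
  | succ s ih =>
    refine KnownAt.extendToStars P ((hR s).mono (Nat.le_add_right t _)) ih
      ((hC s).mono (Nat.le_add_right t _)) ((hC' s).mono (Nat.le_add_right t _)) fun M v u h => ?_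
    rcases partialAdj_iff.1 h with h | h | h
    · exact h.1
    · exact h.1.1
    · exact h.1.1.symm

end

end SparseNetwork

/-! ### The algorithm for a fixed number of nodes -/

theorem NodeEdgeProblem.Solves.congr {L : Type u} {V : Type} [Fintype V] {P : NodeEdgeProblem L}
    {G : SimpleGraph V} {h h' : V → V → L} (hs : P.Solves G.Adj h)
    (he : ∀ v u, G.Adj v u → h v u = h' v u) : P.Solves G.Adj h' := by
  have hc : ∀ v, collect G.Adj h' v = collect G.Adj h v := fun v =>
    Multiset.map_congr rfl fun u hu => (he v u (by simpa using hu)).symm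
  refine ⟨fun v => hc v ▸ hs.1 v, fun v u a => ?_⟩
  rw [← he v u a, ← he u v a.symm]
  exact hs.2 v u a

namespace SparseNetwork

variable {n c a : ℕ}

/-- The output is any value realised in some network with this view and port; it does not matter
which network, because the quantity is known. -/
theorem KnownAt.exists_eq {X : Type*} [Nonempty X] {t : ℕ}
    {H : ∀ M : SparseNetwork n c a, M.V → M.V → X} (h : KnownAt t H) :
    ∃ φ : LocalView → ℕ → X, ∀ (M : SparseNetwork n c a) v u, M.G.Adj v u →
      H M v u = φ (M.N.view t v) (M.prt v u) := by
  classical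
  refine ⟨fun s p => if hx : ∃ (x : X) (M : SparseNetwork n c a) (v u : M.V), M.G.Adj v u ∧
    M.N.view t v = s ∧ M.prt v u = p ∧ H M v u = x then hx.choose else Classical.arbitrary X, ?_⟩
  intro M v u hvu
  have hx : ∃ (x : X) (M' : SparseNetwork n c a) (v' u' : M'.V), M'.G.Adj v' u' ∧
    M'.N.view t v' = M.N.view t v ∧ M'.prt v' u' = M.prt v u ∧ H M' v' u' = x :=
    ⟨_, M, v, u, hvu, rfl, rfl, rfl⟩
  beta_reduce
  rw [dif_pos hx]
  obtain ⟨M', v', u', h1, h2, h3, h4⟩ := hx.choose_spec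
  rw [← h4]
  exact h _ _ _ _ _ _ h2.symm hvu h1 h3.symm

theorem remaining_eq_empty {K T : ℕ} (hT : (4 * a) ^ T * n < (K + 1) ^ T)
    (M : SparseNetwork n c a) : M.G.remaining K (2 * a) T = ∅ :=
  SimpleGraph.remaining_eq_empty M.sparse (by rwa [M.card_eq])

theorem ncard_typical_le {K T : ℕ} (hT : (4 * a) ^ T * n < (K + 1) ^ T)
    (M : SparseNetwork n c a) (v : M.V) :
    {u | (M.G.typical K (2 * a)).Adj v u}.ncard ≤ min K n := by
  refine le_min (SimpleGraph.ncard_typical_le (remaining_eq_empty hT M) v) ?_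
  refine le_trans (Set.ncard_le_ncard (Set.subset_univ _) (Set.toFinite _)) ?_
  rw [Set.ncard_univ, M.card_eq]

theorem typical_le {K b : ℕ} (M : SparseNetwork n c a) : M.G.typical K b ≤ M.G :=
  fun _ _ h => h.1

/-- The rounds are 3T + 4 for the decomposition, the running time of `A` on the padded typical
graph, and two for each of the 4a star classes. -/
theorem exists_output_function {L : Type u} [Nonempty L] {P : NodeEdgeProblem L}
    (hP : P.ListSolvable) (hc : 1 ≤ c) {A : LocalAlgorithm L}
    (hA : ∀ (V E : Type) [Finite V] [Nonempty V] [Finite E] (S : SemiGraph V E)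
      (N : LocalNetwork S c), P.IsSolution S (A.output N))
    {K T : ℕ} (hT : (4 * a) ^ T * n < (K + 1) ^ T) :
    ∃ φ : LocalView → ℕ → L, ∀ M : SparseNetwork n c a, P.Solves M.G.Adj fun v u =>
      φ (M.N.view (3 * T + 4 + A.rounds (n + (min K n + 1)) (min K n) + 2 * (2 * (2 * a))) v)
        (M.prt v u) := by
  have hE := fun M : SparseNetwork n c a => remaining_eq_empty hT M
  have h0 := KnownAt.paddedLabel A (hc := hc) (hH := typical_le)
    ((KnownAt.typical hE).mono (by omega : _ ≤ 3 * T + 4)) (ncard_typical_le hT)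
    (A.rounds (n + (min K n + 1)) (min K n))
  obtain ⟨φ, hφ⟩ := (KnownAt.extendedLabel (P := P) hE (Nat.le_add_right _ _) h0
    (2 * (2 * a))).exists_eq
  refine ⟨φ, fun M => ?_⟩
  have h1 : P.Solves (M.G.typical K (2 * a)).Adj _ := solves_paddedLabel
    (hc := hc) (H := fun M => M.G.typical K (2 * a)) (hH := typical_le) (D := min K n) A (M := M)
    (hA _ _ _ _)
  have h2 : A.time (paddedNetwork hc (H := fun M => M.G.typical K (2 * a)) typical_le (min K n) M) =
      A.rounds (n + (min K n + 1)) (min K n) := by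
    rw [LocalAlgorithm.time, card_padded, underlyingDegree_padded (ncard_typical_le hT M)]
  rw [h2] at h1
  have h3 := solves_extendedLabel hP (hE M) h1 (2 * (2 * a))
  rw [partialAdj_eq_adj] at h3
  exact h3.congr fun v u h => hφ M v u h

end SparseNetwork

/-! ### The running time -/

theorem logStar_mono : Monotone logStar := by
  intro n m
  induction n using Nat.strong_induction_on generalizing m with
  | _ n ih =>
    intro h
    rw [logStar]
    split_ifs with hn
    · exact Nat.zero_le _
    · rw [logStar.eq_1 m, dif_neg (by omega)]
      refine Nat.succ_le_succ (ih _ ?_ (Nat.clog_mono_right 2 h))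
      have h1 : n - 1 < 2 ^ (n - 1) := Nat.lt_two_pow_self
      have h2 : Nat.clog 2 n ≤ n - 1 := Nat.clog_le_of_le_pow (by omega)
      omega

theorem logStar_two_pow_le (n : ℕ) : logStar (2 ^ n) ≤ logStar n + 1 := by
  rw [logStar]
  split_ifs with h
  · exact Nat.zero_le _
  · rw [Nat.clog_pow 2 n one_lt_two]

/-- Two logarithms suffice since 2n + 2 ≤ 2^(2^n). This absorbs the growth of the network caused by
padding. -/
theorem logStar_le_add_two {n m : ℕ} (h : m ≤ 2 * n + 2) : logStar m ≤ logStar n + 2 := by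
  have h1 : m ≤ 2 ^ 2 ^ n := by
    have h2 : n + 1 ≤ 2 ^ n := Nat.lt_two_pow_self
    calc m ≤ 2 * (n + 1) := by omega
      _ ≤ 2 * 2 ^ n := by omega
      _ = 2 ^ (n + 1) := by ring
      _ ≤ _ := Nat.pow_le_pow_right (by norm_num) h2
  have h3 := logStar_mono h1
  have h4 := logStar_two_pow_le (2 ^ n)
  have h5 := logStar_two_pow_le n
  omega

theorem mul_log_four_le : 10 * Real.log 4 ≤ 9 * Real.log 5 := by
  have h : Real.log ((4 : ℝ) ^ 10) ≤ Real.log ((5 : ℝ) ^ 9) :=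
    Real.log_le_log (by norm_num) (by norm_num)
  rwa [Real.log_pow, Real.log_pow] at h

/-- The number of peeling steps. -/
theorem exists_steps {f : ℝ≥0 → ℝ≥0} (hf : Monotone f) {x : ℝ≥0} {n ρ a : ℕ} (hn : 1 ≤ n)
    (hx : x ^ (f x : ℝ) = (n : ℝ≥0)) (hρ : 1 ≤ ρ) (ha : 1 ≤ a) (h : (a : ℝ) ≤ (x : ℝ) ^ ρ / 5) :
    ∃ T : ℕ, (4 * a) ^ T * n < (⌊x ^ ρ⌋₊ + 1) ^ T ∧
      (T : ℝ) ≤ 10 * (ρ * f (x ^ ρ) / (ρ - Real.logb x a)) + 1 ∧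
      (f (x ^ ρ) : ℝ) ≤ ρ * f (x ^ ρ) / (ρ - Real.logb x a) := by
  have ha' : (1 : ℝ) ≤ a := by exact_mod_cast ha
  have hρ' : (1 : ℝ) ≤ ρ := by exact_mod_cast hρ
  have hn' : (1 : ℝ) ≤ n := by exact_mod_cast hn
  have hk : 5 * (a : ℝ) ≤ (x : ℝ) ^ ρ := by linarith
  have hx1 : (1 : ℝ) < x := by
    by_contra! hle
    have := pow_le_one₀ (n := ρ) x.coe_nonneg hle
    linarith
  have hlx : 0 < Real.log x := Real.log_pos hx1
  have hla : 0 ≤ Real.log a := Real.log_nonneg ha'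
  have hlb : 0 ≤ Real.logb x a := div_nonneg hla hlx.le
  have hmul : Real.log x * Real.logb x a = Real.log a := mul_div_cancel₀ _ hlx.ne'
  have hlk : Real.log 5 + Real.log a ≤ ρ * Real.log x := by
    rw [← Real.log_pow, ← Real.log_mul (by norm_num) (by linarith)]
    exact Real.log_le_log (by linarith) hk
  have hl5 : 0 < Real.log 5 := Real.log_pos (by norm_num)
  have hden : 0 < ρ - Real.logb x a := by
    have : 0 < Real.log x * (ρ - Real.logb x a) := by rw [mul_sub, hmul]; linarith
    exact (pos_iff_pos_of_mul_pos this).1 hlx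
  set F : ℝ := ((f (x ^ ρ) : ℝ≥0) : ℝ) with hF
  have hF0 : 0 ≤ F := NNReal.coe_nonneg _
  have hfx : (f x : ℝ) ≤ F := by
    have : x ≤ x ^ ρ := le_self_pow₀ (by exact_mod_cast hx1.le) (by omega)
    exact_mod_cast hf this
  have hlogn : Real.log n = f x * Real.log x := by
    rw [← Real.log_rpow (by linarith)]
    congr 1
    exact_mod_cast congrArg NNReal.toReal hx.symm
  have hlogn0 : 0 ≤ Real.log n := Real.log_nonneg hn'
  -- After taking logarithms, (4a)^T·n < (x^ρ)^T reads log n < T·q, where log n = f(x)·log x.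
  set q := ρ * Real.log x - Real.log a - Real.log 4 with hq
  have h45 := mul_log_four_le
  have hq0 : 0 < q := by linarith
  -- From 5a ≤ x^ρ, log 5 ≤ ρ log x - log a; as 4^10 ≤ 5^9, subtracting log 4 leaves at least a
  -- tenth of the right side. This is the source of the factor 10.
  have hqL : Real.log x * (ρ - Real.logb x a) ≤ 10 * q := by
    rw [mul_sub, hmul]; linarith
  refine ⟨⌊Real.log n / q⌋₊ + 1, ?_, ?_, ?_⟩
  · set T := ⌊Real.log n / q⌋₊ + 1 with hTdef
    have hT : Real.log n < T * q := by
      rw [← div_lt_iff₀ hq0, hTdef]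
      push_cast
      exact Nat.lt_floor_add_one _
    have hlt : ((4 * a : ℝ)) ^ T * n < ((x : ℝ) ^ ρ) ^ T := by
      rw [← Real.log_lt_log_iff (by positivity) (by positivity), Real.log_mul (by positivity)
        (by positivity), Real.log_pow, Real.log_pow, Real.log_pow, Real.log_mul (by norm_num)
        (by positivity)]
      rw [hq] at hT
      linarith
    have hle : ((x : ℝ) ^ ρ) ^ T ≤ ((⌊x ^ ρ⌋₊ : ℝ) + 1) ^ T := by
      refine pow_le_pow_left₀ (by positivity) ?_ T
      have := (Nat.lt_floor_add_one (x ^ ρ)).le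
      exact_mod_cast this
    have := hlt.trans_le hle
    exact_mod_cast this
  · push_cast
    refine add_le_add_left ((Nat.floor_le (div_nonneg hlogn0 hq0.le)).trans ?_) 1
    rw [mul_div_assoc', div_le_div_iff₀ hq0 hden, hlogn]
    calc f x * Real.log x * (ρ - Real.logb x a) = f x * (Real.log x * (ρ - Real.logb x a)) := by ring
      _ ≤ F * (10 * q) := mul_le_mul hfx hqL (mul_nonneg hlx.le hden.le) hF0
      _ ≤ ρ * (F * (10 * q)) := le_mul_of_one_le_left (by positivity) hρ'
      _ = 10 * (ρ * F) * q := by ring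
  · rw [le_div_iff₀ hden, mul_comm]
    exact mul_le_mul_of_nonneg_right (by linarith) hF0

theorem mainTheorem2 {L : Type u} (P : NodeEdgeProblem L)
    (f : ℝ≥0 → ℝ≥0) (hf_cont : Continuous f) (hf_mono : Monotone f) (hf_zero : f 0 = 0)
    (hf_nonzero : ∃ x, 0 < f x)
    (g : ℕ → ℝ≥0) (hg : ∀ n : ℕ, 1 ≤ n → g n ^ (f (g n) : ℝ) = (n : ℝ≥0))
    (c : ℕ) (hc : 1 ≤ c)
    (hA : ∃ (A : LocalAlgorithm L) (C : ℝ),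
      ∀ (V E : Type) [Finite V] [Nonempty V] [Finite E] (S : SemiGraph V E)
        (N : LocalNetwork S c),
        (A.time N : ℝ) ≤ C * (f (S.underlyingDegree : ℝ≥0) + logStar (Nat.card V)) ∧
          P.IsSolution S (A.output N))
    (hstar : ∀ (V E : Type) [Finite V] [Finite E] (S : SemiGraph V E)
      (hin : V → Set (Multiset L)), P.IsNodeListInstance S hin →
        ∃ h : S.HalfEdge → L, P.IsNodeListSolution S hin h) :
    ∃ C : ℝ, ∀ ρ : ℕ, 1 ≤ ρ → ∀ a : ℕ, 1 ≤ a → ∃ A : LocalAlgorithm L,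
      ∀ (V : Type) [Finite V] [Nonempty V] (G : SimpleGraph V) (N : LocalNetwork G.toSemiGraph c),
        G.arboricity ≤ a → (a : ℝ) ≤ (g (Nat.card V) : ℝ) ^ ρ / 5 →
        (A.time N : ℝ) ≤ C * (a
            + ρ * f (g (Nat.card V) ^ ρ) / (ρ - Real.logb (g (Nat.card V)) a)
            + logStar (Nat.card V)) ∧
          P.IsSolution G.toSemiGraph (A.output N) := by
  obtain ⟨A, C, hA⟩ := hA
  have : Nonempty L := ⟨A.out (A.init 0 0 0 0) 0⟩
  -- With X the middle term of the bound, 3T ≤ 30X + 3 and the star classes cost 8a; additive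
  -- constants are absorbed by a ≥ 1. The simulation costs at most max C 0 · (X + log* n + 2).
  refine ⟨45 + 3 * max C 0, fun ρ hρ a ha => ?_⟩
  have hsteps : ∀ n : ℕ, ∃ T : ℕ, 1 ≤ n → (a : ℝ) ≤ (g n : ℝ) ^ ρ / 5 →
      (4 * a) ^ T * n < (⌊g n ^ ρ⌋₊ + 1) ^ T ∧
      (T : ℝ) ≤ 10 * (ρ * f (g n ^ ρ) / (ρ - Real.logb (g n) a)) + 1 ∧
      (f (g n ^ ρ) : ℝ) ≤ ρ * f (g n ^ ρ) / (ρ - Real.logb (g n) a) := by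
    intro n
    by_cases h : 1 ≤ n ∧ (a : ℝ) ≤ (g n : ℝ) ^ ρ / 5
    · obtain ⟨T, hT⟩ := exists_steps hf_mono h.1 (hg n h.1) hρ ha h.2
      exact ⟨T, fun _ _ => hT⟩
    · exact ⟨0, fun h1 h2 => absurd ⟨h1, h2⟩ h⟩
  choose T hT using hsteps
  -- Degrees are at most n anyway; the cap keeps the padded network at no more than 2n + 1 nodes.
  set D : ℕ → ℕ := fun n => min ⌊g n ^ ρ⌋₊ n with hD
  set R : ℕ → ℕ := fun n =>
    3 * T n + 4 + A.rounds (n + (D n + 1)) (D n) + 2 * (2 * (2 * a)) with hR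
  have hout : ∀ n : ℕ, ∃ φ : LocalView → ℕ → L, 1 ≤ n → (a : ℝ) ≤ (g n : ℝ) ^ ρ / 5 →
      ∀ M : SparseNetwork n c a, P.Solves M.G.Adj fun v u => φ (M.N.view (R n) v) (M.prt v u) := by
    intro n
    by_cases h : 1 ≤ n ∧ (a : ℝ) ≤ (g n : ℝ) ^ ρ / 5
    · obtain ⟨φ, hφ⟩ := SparseNetwork.exists_output_function (P := P) hstar hc
        (fun V E _ _ _ S N => (hA V E S N).2) (hT n h.1 h.2).1
      exact ⟨φ, fun _ _ => hφ⟩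
    · exact ⟨fun _ _ => Classical.arbitrary L, fun h1 h2 => absurd ⟨h1, h2⟩ h⟩
  choose φ hφ using hout
  -- The output functions for the separate values of n merge into one algorithm because a view
  -- records n.
  refine ⟨gatherAlgorithm R fun s => φ s.size s, ?_⟩
  intro V _ _ G N hG hcond
  let : Fintype V := Fintype.ofFinite V
  set n := Nat.card V with hn
  have hn1 : 1 ≤ n := Nat.card_pos
  let M : SparseNetwork n c a := ⟨V, G, N, rfl, fun W =>
    (G.sum_degIn_le_arboricity W).trans (by gcongr)⟩
  obtain ⟨hT1, hT2, hT3⟩ := hT n hn1 hcond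
  constructor
  · have h1 := (hA _ _ _ (SparseNetwork.paddedNetwork hc
      (H := fun M : SparseNetwork n c a => M.G.typical ⌊g n ^ ρ⌋₊ (2 * a))
      SparseNetwork.typical_le (D n) M)).1
    rw [LocalAlgorithm.time, SparseNetwork.card_padded,
      SparseNetwork.underlyingDegree_padded (SparseNetwork.ncard_typical_le hT1 M)] at h1
    have h2 : (f (D n : ℝ≥0) : ℝ) ≤ f (g n ^ ρ) := by
      have : ((D n : ℕ) : ℝ≥0) ≤ g n ^ ρ :=
        le_trans (by exact_mod_cast min_le_left _ _) (Nat.floor_le (zero_le))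
      exact_mod_cast hf_mono this
    have h3 : (logStar (n + (D n + 1)) : ℝ) ≤ logStar n + 2 := by
      have : D n ≤ n := min_le_right _ _
      exact_mod_cast logStar_le_add_two (by omega)
    set X : ℝ := ρ * f (g n ^ ρ) / (ρ - Real.logb (g n) a)
    set C' := max C 0
    have hC' : 0 ≤ C' := le_max_right _ _
    have hX : 0 ≤ X := le_trans (NNReal.coe_nonneg _) hT3
    have ha' : (1 : ℝ) ≤ a := by exact_mod_cast ha
    have hl : (0 : ℝ) ≤ logStar n := Nat.cast_nonneg _
    have h4 : (A.rounds (n + (D n + 1)) (D n) : ℝ) ≤ C' * (X + (logStar n + 2)) :=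
      calc _ ≤ C * (f (D n : ℝ≥0) + logStar (n + (D n + 1))) := h1
        _ ≤ C' * (f (D n : ℝ≥0) + logStar (n + (D n + 1))) := by
          gcongr
          exact le_max_left _ _
        _ ≤ _ := by
          gcongr
          exact h2.trans hT3
    show ((R n : ℕ) : ℝ) ≤ _
    rw [hR]
    push_cast
    nlinarith [mul_nonneg hC' hX, mul_nonneg hC' hl, mul_nonneg hC' (sub_nonneg.2 ha')]
  · rw [NodeEdgeProblem.isSolution_output_iff]
    refine (hφ n hn1 hcond M).congr fun v u _ => ?_
    rw [gatherAlgorithm_stateAt]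
    show φ n (N.view (R n) v) (N.prt v u) = φ (N.view (R n) v).size (N.view (R n) v) (N.prt v u)
    rw [LocalNetwork.view_size]
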